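/- Throughout, a relational structure of signature $\mu=(m_i)_{i\in I}$ is $R=(V,(\rho_i)_{i\in I})$ with $\rho_i\subseteq V^{m_i}$, $m_i\in\mathbb N$; the signature is finite if $I$ is finite. A structure $R$ is embeddable into $R'$ if it is isomorphic to the restriction $R'_{\restriction A}$ of $R'$ to some subset $A$ of its domain. The age of $R$ is the class of finite structures embeddable into $R$. A class of finite structures is hereditary if it contains every structure embeddable into one of its members. A monomorphic part of $R$ is a subset $B\subseteq V$ such that for every $n\in\mathbb N$ and all $n$-element subsets $A,A'$ of $V$ with $A\setminus B=A'\setminus B$, the restrictions $R_{\restriction A}$ and $R_{\restriction A'}$ are isomorphic. A monomorphic decomposition of $R$ is a partition of $V$ into monomorphic parts, called its blocks; it is finite if it has finitely many blocks. Lemma. Let $\mathscr C$ be a hereditary class of finite relational structures of a fixed finite signature $\mu$ such that (*) for every $k\in\mathbb N$, the class contains a structure which has no monomorphic decomposition into at most $k+1$ blocks. Then, among the hereditary subclasses of $\mathscr C$ with property (*), there is one that is minimal with respect to inclusion. Moreover, every such minimal subclass is the age of a relational structure of signature $\mu$ which has no finite monomorphic decomposition. -/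

import Mathlib

open FirstOrder CategoryTheory

universe u v w

namespace MonomorphicDecomposition

section Structure

variable (L : FirstOrder.Language.{u, v}) [L.IsRelational] {M : Type w} [L.Structure M]

/-- The restriction of a relational structure to a subset `A` of its domain. -/
def restriction (A : Set M) : L.Substructure M where
  carrier := A
  fun_mem := fun f => isEmptyElim f

/-- `B` is a monomorphic part of `M`: the restrictions of `M` to any two finite subsets `A`, `A'`
of the same size are isomorphic whenever `A` and `A'` coincide outside `B`. -/
def IsMonomorphicPart (B : Set M) : Prop :=
  ∀ A A' : Finset M, A.card = A'.card → (A : Set M) \ B = (A' : Set M) \ B →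
    Nonempty (restriction L (A : Set M) ≃[L] restriction L (A' : Set M))

/-- A partition of the domain (into nonempty blocks) all of whose blocks are monomorphic parts. -/
def IsMonomorphicDecomposition (P : Set (Set M)) : Prop :=
  Setoid.IsPartition P ∧ ∀ B ∈ P, IsMonomorphicPart L B

variable (M)

/-- `M` has a monomorphic decomposition into at most `l` blocks. -/
def HasDecompositionAtMost (l : ℕ) : Prop :=
  ∃ P : Set (Set M), IsMonomorphicDecomposition L P ∧ P.encard ≤ l

/-- `M` has a monomorphic decomposition into finitely many blocks. -/
def HasFiniteDecomposition : Prop :=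
  ∃ P : Set (Set M), IsMonomorphicDecomposition L P ∧ P.Finite

end Structure

/-- For every `k`, the class `C` contains a structure with no monomorphic decomposition into at
most `k + 1` blocks. -/
def HasUnboundedDecompositions {L : FirstOrder.Language.{u, v}} [L.IsRelational]
    (C : Set (Bundled.{w} L.Structure)) : Prop :=
  ∀ k : ℕ, ∃ M ∈ C, ¬ HasDecompositionAtMost L M (k + 1)

end MonomorphicDecomposition

namespace MonomorphicDecomposition

open FirstOrder.Language FirstOrder.Language.Structure

/-! The argument replaces monomorphic decompositions by chainings: colorings with linearly ordered
color classes such that a relation depends only on the colors of the entries and on the order inside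
each color. The color classes of a chaining are monomorphic parts
(`Chainable.hasDecompositionAtMost`). Conversely, a finite structure with at most `k` monomorphic
blocks is chainable with a number of colors depending only on `k` and the signature
(`exists_chainable_of_hasDecompositionAtMost`).

The gain is that chainability with `k` colors is local: it is decided by subsets of bounded size
(`exists_chainable_local_bound`). Otherwise there are arbitrarily large structures that are not
`k`-chainable while all their point deletions are. A large structure of this kind is chainable with
a fixed larger number of colors (`chainable_of_forall_compl_singleton`), and finite structures
chainable with a fixed number of colors are well-quasi-ordered by embeddability. So one embeds into
a strictly larger one, hence into a point deletion of it, and is `k`-chainable after all.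

Zorn's lemma then gives a minimal class. Over a finite signature, some member of a chain of
hereditary classes has the same small structures as the intersection. If the intersection had
bounded decompositions, locality would make every structure in that member chainable with boundedly
many colors, a contradiction.

In a minimal class, the members omitting a given member form a proper hereditary subclass, so every
structure that needs enough blocks embeds that member. This yields joint embedding, and Fraïssé's
theorem makes the class an age. A finite decomposition of the ambient structure would restrict to
all of its finite substructures. -/

/-- The tuples `x` and `y` have the same colors, and their entries of equal color are ordered in
the same way by the positions. -/
structure SamePattern {α β κ : Type*} (f : α → κ) (p : α → ℕ) (g : β → κ) (q : β → ℕ) {a : ℕ}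
    (x : Fin a → α) (y : Fin a → β) : Prop where
  color : ∀ i, f (x i) = g (y i)
  order : ∀ i j, f (x i) = f (x j) → (p (x i) < p (x j) ↔ q (y i) < q (y j))

theorem SamePattern.symm {α β κ : Type*} {f : α → κ} {p : α → ℕ} {g : β → κ} {q : β → ℕ} {a : ℕ}
    {x : Fin a → α} {y : Fin a → β} (h : SamePattern f p g q x y) : SamePattern g q f p y x :=
  ⟨fun i => (h.color i).symm, fun i j hij =>
    (h.order i j (by rw [h.color, h.color, hij])).symm⟩

theorem SamePattern.trans {α β γ κ : Type*} {f : α → κ} {p : α → ℕ} {g : β → κ} {q : β → ℕ}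
    {f' : γ → κ} {p' : γ → ℕ} {a : ℕ} {x : Fin a → α} {y : Fin a → β} {z : Fin a → γ}
    (h : SamePattern f p g q x y) (h' : SamePattern g q f' p' y z) : SamePattern f p f' p' x z :=
  ⟨fun i => (h.color i).trans (h'.color i), fun i j hij =>
    (h.order i j hij).trans (h'.order i j (by rw [← h.color, ← h.color, hij]))⟩

/-! ### Order-preserving maps between colored finite sets. -/

theorem exists_strictMono_subtype_map {α β : Type*} (S : Finset α) (T : Finset β)
    (p : α → ℕ) (q : β → ℕ) (hp : Set.InjOn p S) (hq : Set.InjOn q T) (h : S.card ≤ T.card) :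
    ∃ φ : S → T, ∀ x y : S, p x < p y → q (φ x) < q (φ y) := by
  classical
  have hS : (S.image p).card = S.card := Finset.card_image_of_injOn hp
  have hT : (T.image q).card = T.card := Finset.card_image_of_injOn hq
  let e := (S.image p).orderIsoOfFin hS
  let e' := (T.image q).orderIsoOfFin hT
  have key : ∀ y : (T.image q), ∃ t : T, q t = y := by
    rintro ⟨y, hy⟩
    obtain ⟨t, ht, rfl⟩ := Finset.mem_image.1 hy
    exact ⟨⟨t, ht⟩, rfl⟩
  choose τ hτ using key
  refine ⟨fun x => τ (e' (Fin.castLE h (e.symm ⟨p x, Finset.mem_image_of_mem p x.2⟩))), ?_⟩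
  intro x y hxy
  rw [hτ, hτ]
  have : e.symm ⟨p x, Finset.mem_image_of_mem p x.2⟩
      < e.symm ⟨p y, Finset.mem_image_of_mem p y.2⟩ := e.symm.strictMono hxy
  exact e'.strictMono (Fin.castLE_lt_castLE_iff h |>.2 this)

/-- A finite colored set maps into another one, preserving colors and the order of positions in each
color, if it has at most as many elements of each color. -/
theorem exists_color_order_map {α β κ : Type*} [DecidableEq κ] (f : α → κ) (g : β → κ)
    (p : α → ℕ) (q : β → ℕ) (S : Finset α) (T : Finset β)
    (hp : ∀ x ∈ S, ∀ y ∈ S, f x = f y → p x = p y → x = y)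
    (hq : ∀ x ∈ T, ∀ y ∈ T, g x = g y → q x = q y → x = y)
    (h : ∀ c, (S.filter (f · = c)).card ≤ (T.filter (g · = c)).card) :
    ∃ φ : S → T, (∀ x : S, g (φ x) = f x) ∧
      ∀ x y : S, f x = f y → (p x < p y ↔ q (φ x) < q (φ y)) := by
  have key : ∀ c, ∃ φ : S.filter (f · = c) → T.filter (g · = c),
      ∀ x y : S.filter (f · = c), p x < p y → q (φ x) < q (φ y) := by
    intro c
    apply exists_strictMono_subtype_map _ _ _ _ _ _ (h c)
    · intro x hx y hy hxy
      simp only [Finset.coe_filter, Set.mem_ofPred_eq] at hx hy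
      exact hp x hx.1 y hy.1 (hx.2.trans hy.2.symm) hxy
    · intro x hx y hy hxy
      simp only [Finset.coe_filter, Set.mem_ofPred_eq] at hx hy
      exact hq x hx.1 y hy.1 (hx.2.trans hy.2.symm) hxy
  choose φ hφ using key
  have hlt : ∀ x y : S, f x = f y → p x < p y →
      q (φ (f x) ⟨x, Finset.mem_filter.2 ⟨x.2, rfl⟩⟩)
        < q (φ (f y) ⟨y, Finset.mem_filter.2 ⟨y.2, rfl⟩⟩) := by
    rintro ⟨x, hx⟩ ⟨y, hy⟩ hxy hlt
    dsimp only at hxy hlt ⊢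
    have : ∀ c (hc : f x = c), q (φ c ⟨x, Finset.mem_filter.2 ⟨hx, hc⟩⟩) =
        q (φ (f x) ⟨x, Finset.mem_filter.2 ⟨hx, rfl⟩⟩) := by rintro c rfl; rfl
    rw [← this (f y) hxy]
    exact hφ _ _ _ hlt
  refine ⟨fun x => ⟨φ (f x) ⟨x, Finset.mem_filter.2 ⟨x.2, rfl⟩⟩,
    (Finset.mem_filter.1 (φ (f x) _).2).1⟩, fun x => (Finset.mem_filter.1 (φ (f x) _).2).2, ?_⟩
  intro x y hxy
  refine ⟨hlt x y hxy, fun hq' => ?_⟩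
  by_contra hn
  rcases (not_lt.1 hn).eq_or_lt with he | hl
  · have : x = y := Subtype.ext (hp x x.2 y y.2 hxy he.symm)
    subst this
    exact lt_irrefl _ hq'
  · exact lt_asymm hq' (hlt y x hxy.symm hl)

/-! ### Chainings and their behavior under restriction and embedding. -/

section Chaining

variable (L : FirstOrder.Language.{u, v}) {M : Type*} [L.Structure M]

/-- On `s`, every relation depends only on the colors of the entries and on the order of the
positions of the entries of equal color. -/
structure IsChaining {κ : Type*} (f : M → κ) (p : M → ℕ) (s : Set M) : Prop where
  inj : ∀ x ∈ s, ∀ y ∈ s, f x = f y → p x = p y → x = y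
  rel : ∀ (a : ℕ) (r : L.Relations a) (x y : Fin a → M), (∀ i, x i ∈ s) → (∀ i, y i ∈ s) →
    SamePattern f p f p x y → RelMap r x → RelMap r y

/-- `s` has a chaining with at most `k` colors. -/
def Chainable (k : ℕ) (s : Set M) : Prop :=
  ∃ (f : M → ℕ) (p : M → ℕ), (∀ x ∈ s, f x < k) ∧ IsChaining L f p s

variable {L}

theorem IsChaining.mono {κ : Type*} {f : M → κ} {p : M → ℕ} {s t : Set M}
    (h : IsChaining L f p t) (hst : s ⊆ t) : IsChaining L f p s :=
  ⟨fun x hx y hy => h.inj x (hst hx) y (hst hy), fun a r x y hx hy =>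
    h.rel a r x y (fun i => hst (hx i)) (fun i => hst (hy i))⟩

theorem Chainable.mono {k l : ℕ} {s t : Set M} (h : Chainable L k t) (hst : s ⊆ t) (hkl : k ≤ l) :
    Chainable L l s := by
  obtain ⟨f, p, hf, hc⟩ := h
  exact ⟨f, p, fun x hx => (hf x (hst hx)).trans_le hkl, hc.mono hst⟩

/-- Only equality of colors matters, so colors of any type can be renumbered by an initial segment
of the naturals. This allows colorings by structured data such as `cutColor`. -/
theorem IsChaining.chainable {κ : Type*} {f : M → κ} {p : M → ℕ} {s : Set M}
    (h : IsChaining L f p s) (F : Finset κ) (hF : ∀ x ∈ s, f x ∈ F) {k : ℕ} (hk : F.card ≤ k) :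
    Chainable L k s := by
  classical
  let g : M → ℕ := fun x => if hx : f x ∈ F then (F.equivFin ⟨f x, hx⟩ : ℕ) else 0
  have hg : ∀ x ∈ s, ∀ y ∈ s, (g x = g y ↔ f x = f y) := by
    intro x hx y hy
    simp only [g, dif_pos (hF x hx), dif_pos (hF y hy)]
    rw [Fin.val_inj, F.equivFin.injective.eq_iff, Subtype.mk.injEq]
  refine ⟨g, p, ?_, ?_, ?_⟩
  · intro x hx
    simp only [g, dif_pos (hF x hx)]
    exact (Fin.is_lt _).trans_le hk
  · intro x hx y hy hxy
    exact h.inj x hx y hy ((hg x hx y hy).1 hxy)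
  · intro a r x y hx hy hxy
    refine h.rel a r x y hx hy ⟨fun i => (hg _ (hx i) _ (hy i)).1 (hxy.color i), fun i j hij =>
      hxy.order i j ((hg _ (hx i) _ (hx j)).2 hij)⟩

theorem chainable_image_iff {N : Type*} [L.Structure N] (e : N ↪[L] M) (k : ℕ) (t : Set N) :
    Chainable L k (e '' t) ↔ Chainable L k t := by
  constructor
  · rintro ⟨f, p, hf, hc⟩
    refine ⟨f ∘ e, p ∘ e, fun x hx => hf _ ⟨x, hx, rfl⟩, ?_, ?_⟩
    · intro x hx y hy hxy hp
      exact e.injective (hc.inj _ ⟨x, hx, rfl⟩ _ ⟨y, hy, rfl⟩ hxy hp)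
    · intro a r x y hx hy hxy
      rw [← e.map_rel, ← e.map_rel]
      exact hc.rel a r _ _ (fun i => ⟨_, hx i, rfl⟩) (fun i => ⟨_, hy i, rfl⟩)
        ⟨hxy.color, hxy.order⟩
  · rintro ⟨f, p, hf, hc⟩
    -- The value `0` off the range of `e` is harmless, since only points of `e '' t` are tested.
    have he : ∀ (g : N → ℕ) x, Function.extend e g 0 (e x) = g x := fun g x =>
      e.injective.extend_apply g 0 x
    refine ⟨Function.extend e f 0, Function.extend e p 0, ?_, ?_, ?_⟩
    · rintro _ ⟨x, hx, rfl⟩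
      rw [he]
      exact hf x hx
    · rintro _ ⟨x, hx, rfl⟩ _ ⟨y, hy, rfl⟩
      rw [he, he, he, he]
      intro h1 h2
      rw [hc.inj x hx y hy h1 h2]
    · intro a r x y hx hy hxy
      choose x' hx' hxe using hx
      choose y' hy' hye using hy
      obtain rfl : e ∘ x' = x := funext hxe
      obtain rfl : e ∘ y' = y := funext hye
      rw [e.map_rel, e.map_rel]
      refine hc.rel a r _ _ hx' hy' ⟨fun i => ?_, fun i j hij => ?_⟩
      · simpa only [Function.comp_apply, he] using hxy.color i
      · have := hxy.order i j
        simp only [Function.comp_apply, he] at this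
        exact this hij

theorem Chainable.of_embedding {k : ℕ} {N : Type*} [L.Structure N] (e : N ↪[L] M) (h : Chainable L k (Set.univ : Set M)) :
    Chainable L k (Set.univ : Set N) :=
  (chainable_image_iff e k _).1 (h.mono (Set.subset_univ _) le_rfl)

end Chaining

/-! ### Restrictions of relational structures. -/

section Restriction

variable {L : FirstOrder.Language.{u, v}} [L.IsRelational] {M N : Type*} [L.Structure M]
  [L.Structure N]

/-- The inclusion of the restriction to `A`. -/
def restrictionEmbedding (A : Set M) : restriction L A ↪[L] M := (restriction L A).subtype

theorem image_restrictionEmbedding_univ (A : Set M) :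
    (restrictionEmbedding (L := L) A) '' Set.univ = A := by
  rw [Set.image_univ]
  exact Subtype.range_coe

theorem chainable_restriction_iff (A : Set M) (k : ℕ) :
    Chainable L k (Set.univ : Set (restriction L A)) ↔ Chainable L k A := by
  rw [← chainable_image_iff (restrictionEmbedding A), image_restrictionEmbedding_univ]

/-- The embedding given by an injection that preserves the relations. -/
def embeddingOfInjective (φ : M → N) (hφ : Function.Injective φ)
    (h : ∀ (a : ℕ) (r : L.Relations a) (x : Fin a → M), RelMap r (φ ∘ x) ↔ RelMap r x) :
    M ↪[L] N where
  toFun := φ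
  inj' := hφ
  map_fun' := fun f => isEmptyElim f
  map_rel' := fun r x => h _ r x

/-- The isomorphism given by a bijection that preserves the relations. -/
noncomputable def equivOfBijective (φ : M → N) (hφ : Function.Bijective φ)
    (h : ∀ (a : ℕ) (r : L.Relations a) (x : Fin a → M), RelMap r (φ ∘ x) ↔ RelMap r x) :
    M ≃[L] N where
  toEquiv := Equiv.ofBijective φ hφ
  map_fun' := fun f => isEmptyElim f
  map_rel' := fun r x => h _ r x

end Restriction

theorem exists_arity_bound (L : FirstOrder.Language.{u, v}) [Finite (Σ n : ℕ, L.Relations n)] :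
    ∃ m : ℕ, ∀ a, L.Relations a → a ≤ m := by
  obtain ⟨m, hm⟩ := (Set.finite_range (fun p : Σ n : ℕ, L.Relations n => p.1)).bddAbove
  exact ⟨m, fun a r => hm ⟨⟨a, r⟩, rfl⟩⟩

/-! ### From chainings to decompositions; isomorphism types determined by block counts. -/

section Decomposition

variable {L : FirstOrder.Language.{u, v}} [L.IsRelational] {M N : Type*} [L.Structure M]
  [L.Structure N]

/-- Sending elements to elements of the same color in increasing order of position preserves
patterns, hence relations. It serves both inside one structure and to compare two different chained
structures. -/
theorem nonempty_embedding_of_counts {κ : Type*} [DecidableEq κ] (f : M → κ) (g : N → κ)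
    (p : M → ℕ) (q : N → ℕ) (S : Finset M) (T : Finset N)
    (hp : ∀ x ∈ S, ∀ y ∈ S, f x = f y → p x = p y → x = y)
    (hq : ∀ x ∈ T, ∀ y ∈ T, g x = g y → q x = q y → x = y)
    (h : ∀ c, (S.filter (f · = c)).card ≤ (T.filter (g · = c)).card)
    (hrel : ∀ (a : ℕ) (r : L.Relations a) (x : Fin a → M) (y : Fin a → N), (∀ i, x i ∈ S) →
      (∀ i, y i ∈ T) → SamePattern f p g q x y → (RelMap r y ↔ RelMap r x)) :
    Nonempty (restriction L (S : Set M) ↪[L] restriction L (T : Set N)) := by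
  obtain ⟨φ, hφc, hφo⟩ := exists_color_order_map f g p q S T hp hq h
  refine ⟨embeddingOfInjective (fun x : restriction L (S : Set M) =>
    (⟨φ ⟨x.1, x.2⟩, (φ ⟨x.1, x.2⟩).2⟩ : restriction L (T : Set N))) ?_ ?_⟩
  · rintro ⟨x, hx⟩ ⟨y, hy⟩ hxy
    have hxy' : φ ⟨x, hx⟩ = φ ⟨y, hy⟩ := Subtype.ext (congrArg Subtype.val hxy)
    have hc : f x = f y := by
      have := hφc ⟨x, hx⟩
      rw [hxy', hφc] at this
      exact this.symm
    have h1 := hφo ⟨x, hx⟩ ⟨y, hy⟩ hc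
    have h2 := hφo ⟨y, hy⟩ ⟨x, hx⟩ hc.symm
    rw [hxy'] at h1 h2
    simp only [lt_irrefl, iff_false, not_lt] at h1 h2
    exact Subtype.ext (hp x hx y hy hc (le_antisymm h2 h1))
  · intro a r x
    exact hrel a r (fun i => (x i).1) (fun i => (φ ⟨(x i).1, (x i).2⟩).1) (fun i => (x i).2)
      (fun i => (φ _).2) ⟨fun i => (hφc _).symm, fun i j hij => hφo ⟨_, _⟩ ⟨_, _⟩ hij⟩

theorem nonempty_equiv_of_embedding {A : Finset M} {B : Finset N} (h : A.card = B.card)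
    (e : restriction L (A : Set M) ↪[L] restriction L (B : Set N)) :
    Nonempty (restriction L (A : Set M) ≃[L] restriction L (B : Set N)) := by
  have hA : Nat.card (restriction L (A : Set M)) = A.card := Set.ncard_coe_finset A
  have hB : Nat.card (restriction L (B : Set N)) = B.card := Set.ncard_coe_finset B
  have : Finite (restriction L (B : Set N)) := inferInstanceAs (Finite (B : Finset N))
  refine ⟨equivOfBijective e (e.injective.bijective_of_nat_card_le ?_)
    fun a r x => e.map_rel r x⟩
  rw [hA, hB, h]

/-- Sets of equal size that agree off one color class have equal counts in every color, so the
monotone matching of colors is an embedding, and by cardinality an isomorphism. -/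
theorem IsChaining.isMonomorphicPart {f p : M → ℕ} (h : IsChaining L f p Set.univ) (c : ℕ) :
    IsMonomorphicPart L (f ⁻¹' {c}) := by
  classical
  intro A A' hcard hdiff
  have hmem : ∀ x, f x ≠ c → (x ∈ A ↔ x ∈ A') := by
    intro x hx
    have := congrArg (x ∈ ·) hdiff
    simpa [hx] using this
  have hne : ∀ d, d ≠ c → A.filter (f · = d) = A'.filter (f · = d) := by
    intro d hd
    ext x
    simp only [Finset.mem_filter]
    constructor
    · rintro ⟨hx, rfl⟩
      exact ⟨(hmem x hd).1 hx, rfl⟩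
    · rintro ⟨hx, rfl⟩
      exact ⟨(hmem x hd).2 hx, rfl⟩
  have hnec : A.filter (¬ f · = c) = A'.filter (¬ f · = c) := by
    ext x
    simp only [Finset.mem_filter]
    exact ⟨fun hx => ⟨(hmem x hx.2).1 hx.1, hx.2⟩, fun hx => ⟨(hmem x hx.2).2 hx.1, hx.2⟩⟩
  have hcounts : ∀ d, (A.filter (f · = d)).card ≤ (A'.filter (f · = d)).card := by
    intro d
    by_cases hd : d = c
    · subst hd
      have h1 := Finset.card_filter_add_card_filter_not (s := A) (f · = d)
      have h2 := Finset.card_filter_add_card_filter_not (s := A') (f · = d)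
      rw [hnec] at h1
      omega
    · rw [hne d hd]
  have hinj : ∀ B : Finset M, ∀ x ∈ B, ∀ y ∈ B, f x = f y → p x = p y → x = y :=
    fun B x _ y _ => h.inj x trivial y trivial
  obtain ⟨e⟩ := nonempty_embedding_of_counts (L := L) f f p p A A' (hinj A) (hinj A') hcounts
    (fun a r x y _ _ hxy => ⟨h.rel a r y x (fun _ => trivial) (fun _ => trivial) hxy.symm,
      h.rel a r x y (fun _ => trivial) (fun _ => trivial) hxy⟩)
  exact nonempty_equiv_of_embedding hcard e

theorem isMonomorphicPart_empty : IsMonomorphicPart L (∅ : Set M) := by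
  intro A A' _ h
  rw [Set.sdiff_empty, Set.sdiff_empty] at h
  rw [h]
  exact ⟨FirstOrder.Language.Equiv.refl L _⟩

theorem hasDecompositionAtMost_of_coloring {k : ℕ} (f : M → ℕ) (hf : ∀ x, f x < k)
    (h : ∀ c, IsMonomorphicPart L (f ⁻¹' {c})) : HasDecompositionAtMost L M k := by
  refine ⟨(Setoid.ker f).classes, ⟨Setoid.isPartition_classes _, ?_⟩, ?_⟩
  · rintro B ⟨y, rfl⟩
    exact h (f y)
  · have hsub : (Setoid.ker f).classes ⊆ (fun c => f ⁻¹' {c}) '' (Finset.range k : Set ℕ) := by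
      rintro B ⟨y, rfl⟩
      exact ⟨f y, by simpa using hf y, rfl⟩
    refine (Set.encard_le_encard hsub).trans ((Set.encard_image_le _ _).trans ?_)
    rw [Set.encard_coe_eq_coe_finsetCard, Finset.card_range]

theorem HasDecompositionAtMost.exists_coloring {k : ℕ} (h : HasDecompositionAtMost L M k) :
    ∃ f : M → ℕ, (∀ x, f x < k) ∧ ∀ c, IsMonomorphicPart L (f ⁻¹' {c}) := by
  classical
  obtain ⟨P, ⟨hP, hmono⟩, hcard⟩ := h
  have hfin : P.Finite := Set.finite_of_encard_le_coe hcard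
  obtain ⟨F, rfl⟩ := hfin.exists_finset_coe
  rw [Set.encard_coe_eq_coe_finsetCard, Nat.cast_le] at hcard
  choose b hb using fun x => (hP.2 x)
  simp only [and_imp] at hb
  refine ⟨fun x => (F.equivFin ⟨b x, (hb x).1.1⟩ : ℕ), fun x => (Fin.is_lt _).trans_le hcard, ?_⟩
  intro c
  by_cases hc : ∃ y, (F.equivFin ⟨b y, (hb y).1.1⟩ : ℕ) = c
  · obtain ⟨y, rfl⟩ := hc
    convert hmono (b y) (hb y).1.1
    ext x
    simp only [Set.mem_preimage, Set.mem_singleton_iff, Fin.val_inj,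
      F.equivFin.injective.eq_iff, Subtype.mk.injEq]
    constructor
    · intro hxy
      rw [← hxy]
      exact (hb x).1.2
    · intro hx
      exact ((hb x).2 (b y) (hb y).1.1 hx).symm
  · push Not at hc
    convert isMonomorphicPart_empty (L := L) (M := M)
    ext x
    simpa using hc x

theorem Chainable.hasDecompositionAtMost {k : ℕ} (h : Chainable L k (Set.univ : Set M)) :
    HasDecompositionAtMost L M k := by
  obtain ⟨f, p, hf, hc⟩ := h
  exact hasDecompositionAtMost_of_coloring f (fun x => hf x trivial) hc.isMonomorphicPart

theorem HasDecompositionAtMost.mono {k l : ℕ} (h : HasDecompositionAtMost L M k) (hkl : k ≤ l) :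
    HasDecompositionAtMost L M l := by
  obtain ⟨f, hf, hm⟩ := h.exists_coloring
  exact hasDecompositionAtMost_of_coloring f (fun x => (hf x).trans_le hkl) hm

/-- Finite subsets meeting every block of a monomorphic decomposition in the same number of
elements induce isomorphic restrictions. -/
theorem nonempty_equiv_of_counts {k : ℕ} (f : M → ℕ) (hf : ∀ x, f x < k)
    (h : ∀ c, IsMonomorphicPart L (f ⁻¹' {c})) (A A' : Finset M)
    (hcount : ∀ c, (A.filter (f · = c)).card = (A'.filter (f · = c)).card) :
    Nonempty (restriction L (A : Set M) ≃[L] restriction L (A' : Set M)) := by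
  classical
  -- These sets interpolate between `A` and `A'`, exchanging one block at a time; each exchange is
  -- covered by the monomorphy of that block.
  let D : ℕ → Finset M := fun j => A'.filter (f · < j) ∪ A.filter (j ≤ f ·)
  have hfilter : ∀ j c, (D j).filter (f · = c) =
      if c < j then A'.filter (f · = c) else A.filter (f · = c) := by
    intro j c
    ext x
    simp only [D, Finset.mem_filter, Finset.mem_union]
    split_ifs with hcj
    · simp only [Finset.mem_filter]
      constructor
      · rintro ⟨h1 | h1, rfl⟩
        · exact ⟨h1.1, rfl⟩
        · omega
      · rintro ⟨h1, rfl⟩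
        exact ⟨Or.inl ⟨h1, hcj⟩, rfl⟩
    · simp only [Finset.mem_filter]
      constructor
      · rintro ⟨h1 | h1, rfl⟩
        · exact absurd h1.2 hcj
        · exact ⟨h1.1, rfl⟩
      · rintro ⟨h1, rfl⟩
        exact ⟨Or.inr ⟨h1, not_lt.1 hcj⟩, rfl⟩
  have hcard : ∀ j, (D j).card = A.card := by
    intro j
    rw [Finset.card_eq_sum_card_fiberwise (f := f) (t := Finset.range k) (s := D j)
      (fun x _ => by simpa using hf x),
      Finset.card_eq_sum_card_fiberwise (f := f) (t := Finset.range k) (s := A)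
      (fun x _ => by simpa using hf x)]
    refine Finset.sum_congr rfl fun c _ => ?_
    rw [hfilter]
    split_ifs
    · exact (hcount c).symm
    · rfl
  have hstep : ∀ j, Nonempty (restriction L (A : Set M) ≃[L] restriction L (D j : Set M)) := by
    intro j
    induction j with
    | zero =>
      have : D 0 = A := by
        ext x
        simp [D]
      rw [this]
      exact ⟨FirstOrder.Language.Equiv.refl L _⟩
    | succ j ih =>
      obtain ⟨e⟩ := ih
      obtain ⟨e'⟩ := h j (D j) (D (j + 1)) ((hcard j).trans (hcard _).symm) (by
        ext x
        simp only [D, Set.mem_sdiff, Set.mem_preimage, Set.mem_singleton_iff, Finset.coe_union,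
          Finset.coe_filter, Set.mem_union, Set.mem_ofPred_eq]
        have : f x ≠ j → (f x < j ↔ f x < j + 1) ∧ (j ≤ f x ↔ j + 1 ≤ f x) := by omega
        constructor
        · rintro ⟨h1, h2⟩
          rwa [← (this h2).1, ← (this h2).2, and_iff_left h2]
        · rintro ⟨h1, h2⟩
          rwa [(this h2).1, (this h2).2, and_iff_left h2])
      exact ⟨e'.comp e⟩
  have hlast : D k = A' := by
    ext x
    have := hf x
    simp only [D, Finset.mem_union, Finset.mem_filter]
    constructor
    · rintro (h1 | h1)
      · exact h1.1
      · omega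
    · exact fun h1 => Or.inl ⟨h1, this⟩
  rw [← hlast]
  exact hstep k

end Decomposition

/-! ### Cutting the color classes at finitely many points. -/

section Refinement

variable {M : Type*}

/-- The number of elements of `E` of color `c` and position less than `t`. -/
def countBelow (E : Finset M) (f p : M → ℕ) (c t : ℕ) : ℕ :=
  (E.filter fun e => f e = c ∧ p e < t).card

theorem countBelow_mono (E : Finset M) (f p : M → ℕ) (c : ℕ) : Monotone (countBelow E f p c) :=
  fun _ _ hst => Finset.card_le_card fun _ he => by
    rw [Finset.mem_filter] at he ⊢
    exact ⟨he.1, he.2.1, he.2.2.trans_le hst⟩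
theorem countBelow_lt_iff {E : Finset M} (f p : M → ℕ) {e : M} (he : e ∈ E) (t : ℕ) :
    countBelow E f p (f e) (p e) < countBelow E f p (f e) t ↔ p e < t := by
  constructor
  · intro h
    by_contra hn
    exact absurd h (not_lt.2 (countBelow_mono E f p _ (not_lt.1 hn)))
  · intro h
    apply Finset.card_lt_card
    rw [Finset.ssubset_iff_of_subset]
    · exact ⟨e, by simp [he, h], by simp⟩
    · intro x hx
      rw [Finset.mem_filter] at hx ⊢
      exact ⟨hx.1, hx.2.1, hx.2.2.trans h⟩

variable [DecidableEq M]

/-- The coloring `f`, with the elements of `E` made singletons and every color cut at the positions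
of the elements of `E`, where `v` does not count. -/
def cutColor (E : Finset M) (v : M) (f p : M → ℕ) (x : M) : Option M × ℕ × ℕ :=
  if x ∈ E then (some x, 0, 0) else (none, f x, countBelow (E.erase v) f p (f x) (p x))

theorem cutColor_eq_iff_of_mem {E : Finset M} {v : M} {f p : M → ℕ} {x y : M} (hx : x ∈ E) :
    cutColor E v f p x = cutColor E v f p y ↔ x = y := by
  refine ⟨fun h => ?_, fun h => h ▸ rfl⟩
  unfold cutColor at h
  rw [if_pos hx] at h
  split_ifs at h with hy
  · simpa using h
  · simp at h

theorem cutColor_eq_iff_of_notMem {E : Finset M} {v : M} {f p : M → ℕ} {x y : M} (hx : x ∉ E) :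
    cutColor E v f p x = cutColor E v f p y ↔ y ∉ E ∧ f x = f y ∧
      countBelow (E.erase v) f p (f x) (p x) = countBelow (E.erase v) f p (f y) (p y) := by
  unfold cutColor
  rw [if_neg hx]
  split_ifs with hy
  · simp [hy]
  · simp [hy]

/-- A cut color records where a point lies relative to the cutting points of its old color. Points
in different pieces are therefore ordered by their pieces, and points in one piece by the assumed
pattern. The point `v` is excluded because its position carries no information. -/
theorem SamePattern.of_cutColor {E : Finset M} {v : M} {f p : M → ℕ}
    (hinj : ∀ x ≠ v, ∀ y ≠ v, f x = f y → p x = p y → x = y) {a : ℕ} {x y : Fin a → M}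
    (hx : ∀ i, x i ≠ v) (hy : ∀ i, y i ≠ v)
    (h : SamePattern (cutColor E v f p) p (cutColor E v f p) p x y) :
    SamePattern f p f p x y := by
  have hcol : ∀ i, f (x i) = f (y i) := by
    intro i
    by_cases hi : x i ∈ E
    · rw [(cutColor_eq_iff_of_mem hi).1 (h.color i)]
    · exact ((cutColor_eq_iff_of_notMem hi).1 (h.color i)).2.1
  have hmem : ∀ i, x i ∈ E → x i = y i := fun i hi => (cutColor_eq_iff_of_mem hi).1 (h.color i)
  have hcnt : ∀ i, x i ∉ E → countBelow (E.erase v) f p (f (x i)) (p (x i)) =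
      countBelow (E.erase v) f p (f (x i)) (p (y i)) := by
    intro i hi
    have := ((cutColor_eq_iff_of_notMem hi).1 (h.color i)).2.2
    rwa [← hcol i] at this
  have hmixed : ∀ i j, f (x i) = f (x j) → x i ∈ E → x j ∉ E →
      (p (x i) < p (x j) ↔ p (y i) < p (y j)) := by
    intro i j hij hi hj
    rw [← hmem i hi]
    have hi' : x i ∈ E.erase v := Finset.mem_erase.2 ⟨hx i, hi⟩
    rw [← countBelow_lt_iff f p hi', ← countBelow_lt_iff f p hi' (p (y j)), hij, hcnt j hj]
  have hne : ∀ i j, x i ∈ E → x j ∉ E → f (x i) = f (x j) →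
      p (x i) ≠ p (x j) ∧ p (y i) ≠ p (y j) := by
    intro i j hi hj hij
    have hyj : y j ∉ E := ((cutColor_eq_iff_of_notMem hj).1 (h.color j)).1
    refine ⟨fun hp => hj (hinj _ (hx i) _ (hx j) hij hp ▸ hi), fun hp => ?_⟩
    have := hinj _ (hy i) _ (hy j) (by rw [← hcol, ← hcol, hij]) hp
    rw [← hmem i hi] at this
    exact hyj (this ▸ hi)
  refine ⟨hcol, fun i j hij => ?_⟩
  by_cases hi : x i ∈ E <;> by_cases hj : x j ∈ E
  · rw [← hmem i hi, ← hmem j hj]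
  · exact hmixed i j hij hi hj
  · have h1 := hmixed j i hij.symm hj hi
    have h2 := hne j i hj hi hij.symm
    omega
  · have h1 := hcnt i hi
    have h2 := hcnt j hj
    rw [← hij] at h2
    have hm := countBelow_mono (E.erase v) f p (f (x i))
    rcases lt_trichotomy (countBelow (E.erase v) f p (f (x i)) (p (x i)))
      (countBelow (E.erase v) f p (f (x i)) (p (x j))) with hlt | heq | hgt
    · have h3 := hm.reflect_lt hlt
      rw [h1, h2] at hlt
      have h4 := hm.reflect_lt hlt
      simp [h3, h4]
    · refine h.order i j ((cutColor_eq_iff_of_notMem hi).2 ⟨hj, hij, ?_⟩)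
      rw [← hij, heq]
    · have h3 := hm.reflect_lt hgt
      rw [h1, h2] at hgt
      have h4 := hm.reflect_lt hgt
      omega

theorem cutColor_mem {E : Finset M} {v : M} {f p : M → ℕ} {k : ℕ} {x : M}
    (hf : x ∉ E → f x < k) :
    cutColor E v f p x ∈ E.image (fun e => ((some e, 0, 0) : Option M × ℕ × ℕ)) ∪
      (Finset.range k ×ˢ Finset.range (E.card + 1)).image (fun c => (none, c)) := by
  unfold cutColor
  split_ifs with hx
  · exact Finset.mem_union_left _ (Finset.mem_image_of_mem _ hx)
  · refine Finset.mem_union_right _ (Finset.mem_image_of_mem _ ?_)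
    rw [Finset.mem_product, Finset.mem_range, Finset.mem_range]
    exact ⟨hf hx, Nat.lt_succ_of_le ((Finset.card_filter_le _ _).trans
      (Finset.card_le_card (Finset.erase_subset _ _)))⟩

theorem card_cutColor_codomain_le (E : Finset M) (k : ℕ) :
    (E.image (fun e => ((some e, 0, 0) : Option M × ℕ × ℕ)) ∪
      (Finset.range k ×ˢ Finset.range (E.card + 1)).image (fun c => (none, c))).card
      ≤ E.card + k * (E.card + 1) := by
  refine (Finset.card_union_le _ _).trans (add_le_add Finset.card_image_le ?_)
  refine Finset.card_image_le.trans ?_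
  rw [Finset.card_product, Finset.card_range, Finset.card_range]

end Refinement

/-! ### Chaining a large structure whose point deletions are chainable. -/

theorem exists_lower_subset {α : Type*} [DecidableEq α] (p : α → ℕ) (S : Finset α) (n : ℕ)
    (h : n ≤ S.card) : ∃ T ⊆ S, T.card = n ∧ ∀ t ∈ T, ∀ s ∈ S, s ∉ T → p t ≤ p s := by
  induction n with
  | zero => exact ⟨∅, by simp, rfl, by simp⟩
  | succ n ih =>
    obtain ⟨T, hTS, hT, hlow⟩ := ih (by omega)
    have hne : (S \ T).Nonempty := by
      rw [← Finset.card_pos, Finset.card_sdiff_of_subset hTS]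
      omega
    obtain ⟨z, hz, hmin⟩ := Finset.exists_min_image (S \ T) p hne
    rw [Finset.mem_sdiff] at hz
    refine ⟨insert z T, Finset.insert_subset hz.1 hTS, by rw [Finset.card_insert_of_notMem hz.2, hT],
      ?_⟩
    intro t ht s hs hsT
    rw [Finset.mem_insert, not_or] at hsT
    rcases Finset.mem_insert.1 ht with rfl | ht
    · exact hmin s (Finset.mem_sdiff.2 ⟨hs, hsT.2⟩)
    · exact hlow t ht s hs hsT.2

section Extension

variable {L : FirstOrder.Language.{u, v}} {M : Type*} [L.Structure M]

/-- The elements `z ≠ y` with fewer than `n` elements above them in their color are few. -/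
theorem card_few_above_le [Fintype M] [DecidableEq M] {y : M} {f p : M → ℕ} {k : ℕ}
    (hf : ∀ x ∈ ({y}ᶜ : Set M), f x < k) (hc : IsChaining L f p {y}ᶜ) (n : ℕ) :
    (Finset.univ.filter fun z => z ≠ y ∧
      (Finset.univ.filter fun z' => z' ≠ y ∧ f z' = f z ∧ p z < p z').card < n).card ≤ k * n := by
  let A : M → Finset M := fun z => Finset.univ.filter fun z' => z' ≠ y ∧ f z' = f z ∧ p z < p z'
  have hlt : ∀ z z', z' ≠ y → f z = f z' → p z < p z' → (A z').card < (A z).card := by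
    intro z z' hz' hf' hlt
    apply Finset.card_lt_card
    rw [Finset.ssubset_iff_of_subset]
    · exact ⟨z', by simp [A, hz', hf', hlt], by simp [A]⟩
    · intro t ht
      simp only [A, Finset.mem_filter, Finset.mem_univ, true_and] at ht ⊢
      exact ⟨ht.1, ht.2.1.trans hf'.symm, hlt.trans ht.2.2⟩
  have : k * n = (Finset.range k ×ˢ Finset.range n).card := by simp
  rw [this]
  -- Inside a color, the number of elements above a point strictly decreases with its position, so
  -- color and this number identify the point.
  refine Finset.card_le_card_of_injOn (fun z => (f z, (A z).card)) ?_ ?_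
  · intro z hz
    simp only [Finset.coe_filter, Finset.mem_univ, true_and, Set.mem_ofPred_eq] at hz
    simp only [Finset.coe_product, Set.mem_prod, Finset.coe_range, Set.mem_Iio]
    exact ⟨hf z hz.1, hz.2⟩
  · intro z hz z' hz' hzz
    simp only [Finset.coe_filter, Finset.mem_univ, true_and, Set.mem_ofPred_eq] at hz hz'
    simp only [Prod.mk.injEq] at hzz
    rcases lt_trichotomy (p z) (p z') with h | h | h
    · exact absurd hzz.2 (hlt z z' hz'.1 hzz.1 h).ne'
    · exact hc.inj z hz.1 z' hz'.1 hzz.1 h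
    · exact absurd hzz.2 (hlt z' z hz.1 hzz.1.symm h).ne

/-- A convex piece `W` of a color class of a chaining: moving the elements of a small set `Z` inside
`W` off a given element of `W`, in an order-preserving way, does not change any pattern. -/
theorem exists_shift [DecidableEq M] {y v : M} {f p : M → ℕ} (hc : IsChaining L f p {y}ᶜ)
    (W Z : Finset M) (hvW : v ∈ W) (hyW : y ∉ W) (hyZ : y ∉ Z) (hcol : ∀ x ∈ W, f x = f v)
    (hconv : ∀ z ∉ W, z ≠ y → f z = f v → (∀ x ∈ W, p z < p x) ∨ (∀ x ∈ W, p x < p z))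
    (hcard : Z.card < W.card) :
    ∃ σ : M → M, (∀ z ∉ W, σ z = z) ∧ (∀ z ∈ Z, z ∈ W → σ z ∈ W) ∧ (∀ z ∈ Z, σ z ≠ v) ∧
      ∀ (a : ℕ) (r : L.Relations a) (x : Fin a → M), (∀ i, x i ∈ Z) →
        (RelMap r (σ ∘ x) ↔ RelMap r x) := by
  -- All of `W` shares one color and every other point is its own color. A color-preserving map thus
  -- fixes the points outside `W` and moves those of `W` monotonically.
  let h : M → Option M := fun z => if z ∈ W then none else some z
  have hnone : ∀ z, h z = none ↔ z ∈ W := by intro z; simp [h]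
  have hsome : ∀ z z', h z = some z' ↔ z ∉ W ∧ z = z' := by intro z z'; simp [h]
  let T : Finset M := (Z \ W) ∪ W.erase v
  have hinj : ∀ x y', h x = h y' → p x = p y' → x = y' := by
    intro x y' hxy hp
    by_cases hx : x ∈ W
    · have hy' : y' ∈ W := by rw [← hnone, ← hxy, hnone]; exact hx
      exact hc.inj x (fun e => hyW (e ▸ hx)) y' (fun e => hyW (e ▸ hy'))
        ((hcol x hx).trans (hcol y' hy').symm) hp
    · have := (hsome x x).2 ⟨hx, rfl⟩
      rw [hxy, hsome] at this
      exact this.2.symm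
  obtain ⟨φ, hφc, hφo⟩ := exists_color_order_map h h p p Z T (fun x _ y' _ => hinj x y')
    (fun x _ y' _ => hinj x y') (by
      rintro (_ | z)
      · have : T.filter (h · = none) = W.erase v := by
          ext x
          simp only [T, hnone, Finset.mem_filter, Finset.mem_union, Finset.mem_sdiff,
            Finset.mem_erase]
          tauto
        rw [this, Finset.card_erase_of_mem hvW]
        have := Finset.card_filter_le Z (h · = none)
        omega
      · refine Finset.card_le_card fun x hx => ?_
        simp only [T, hsome, Finset.mem_filter, Finset.mem_union, Finset.mem_sdiff,
          Finset.mem_erase] at hx ⊢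
        tauto)
  let σ : M → M := fun z => if hz : z ∈ Z then φ ⟨z, hz⟩ else z
  have hσ : ∀ z (hz : z ∈ Z), σ z = φ ⟨z, hz⟩ := fun z hz => dif_pos hz
  have hσout : ∀ z ∉ W, σ z = z := by
    intro z hzW
    by_cases hz : z ∈ Z
    · rw [hσ z hz]
      have := hφc ⟨z, hz⟩
      rw [(hsome z z).2 ⟨hzW, rfl⟩, hsome] at this
      exact this.2
    · exact dif_neg hz
  have hσin : ∀ z ∈ Z, z ∈ W → σ z ∈ W := by
    intro z hz hzW
    rw [hσ z hz, ← hnone, hφc, hnone]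
    exact hzW
  have hσv : ∀ z ∈ Z, σ z ≠ v := by
    intro z hz hv
    have : σ z ∈ T := by rw [hσ z hz]; exact (φ ⟨z, hz⟩).2
    rw [hv] at this
    simp [T, hvW] at this
  refine ⟨σ, hσout, hσin, hσv, fun a r x hx => ?_⟩
  have hne : ∀ z ∈ Z, z ≠ y := fun z hz e => hyZ (e ▸ hz)
  have hσne : ∀ z ∈ Z, σ z ≠ y := by
    intro z hz
    by_cases hzW : z ∈ W
    · exact fun e => hyW (e ▸ hσin z hz hzW)
    · rw [hσout z hzW]
      exact hne z hz
  have hσf : ∀ z ∈ Z, f z = f (σ z) := by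
    intro z hz
    by_cases hzW : z ∈ W
    · rw [hcol z hzW, hcol _ (hσin z hz hzW)]
    · rw [hσout z hzW]
  have hpat : SamePattern f p f p x (σ ∘ x) := by
    refine ⟨fun i => hσf _ (hx i), fun i j hij => ?_⟩
    simp only [Function.comp_apply]
    by_cases hi : x i ∈ W <;> by_cases hj : x j ∈ W
    · have := hφo ⟨x i, hx i⟩ ⟨x j, hx j⟩ (((hnone _).2 hi).trans ((hnone _).2 hj).symm)
      rwa [← hσ, ← hσ] at this
    · rw [hσout _ hj]
      -- By convexity, an outside point of this color compares in the same way with all of `W`, so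
      -- moving the other entry within `W` changes nothing.
      rcases hconv (x j) hj (hne _ (hx j)) (hij ▸ hcol _ hi) with h1 | h1
      · have h2 := h1 _ hi
        have h3 := h1 _ (hσin _ (hx i) hi)
        omega
      · have h2 := h1 _ hi
        have h3 := h1 _ (hσin _ (hx i) hi)
        omega
    · rw [hσout _ hi]
      rcases hconv (x i) hi (hne _ (hx i)) (hij ▸ hcol _ hj) with h1 | h1
      · have h2 := h1 _ hj
        have h3 := h1 _ (hσin _ (hx j) hj)
        omega
      · have h2 := h1 _ hj
        have h3 := h1 _ (hσin _ (hx j) hj)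
        omega
    · rw [hσout _ hi, hσout _ hj]
  exact ⟨hc.rel a r _ _ (fun i => hσne _ (hx i)) (fun i => hne _ (hx i)) hpat.symm,
    hc.rel a r _ _ (fun i => hne _ (hx i)) (fun i => hσne _ (hx i)) hpat⟩

/-- If all the subsets obtained by removing one element from a large structure are chainable with
`k` colors, then the structure is chainable with a number of colors that depends on `k` and the
arity only. -/
theorem chainable_of_forall_compl_singleton [Fintype M] {m k : ℕ}
    (hm : ∀ a, L.Relations a → a ≤ m)
    (hcard : (2 * m + 1) + (2 * m + 1) * (k * (2 * m)) < Fintype.card M)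
    (h : ∀ y : M, Chainable L k ({y}ᶜ : Set M)) :
    Chainable L ((2 * m + 1) * (2 * m + 1) + k * ((2 * m + 1) * (2 * m + 1) + 1))
      (Set.univ : Set M) := by
  classical
  choose f p hf hc using h
  -- Two tuples of arity at most `m` have at most `2 * m` entries together, so they always miss one
  -- of `2 * m + 1` points, whose deletion leaves a chained set containing both.
  obtain ⟨Y, -, hY⟩ := Finset.exists_subset_card_eq
    (s := (Finset.univ : Finset M)) (n := 2 * m + 1) (by rw [Finset.card_univ]; omega)
  let A : M → M → Finset M := fun y z =>
    Finset.univ.filter fun z' => z' ≠ y ∧ f y z' = f y z ∧ p y z < p y z'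
  let B : M → Finset M := fun y => Finset.univ.filter fun z => z ≠ y ∧ (A y z).card < 2 * m
  have hB : (Y ∪ Y.biUnion B).card < Fintype.card M := by
    refine lt_of_le_of_lt ?_ hcard
    refine (Finset.card_union_le _ _).trans (add_le_add hY.le ?_)
    rw [← hY]
    exact Finset.card_biUnion_le_card_mul _ _ _
      fun y _ => card_few_above_le (hf y) (hc y) (2 * m)
  -- A point outside `Y` that has, for every `y ∈ Y`, at least `2 * m` elements above it in its
  -- color for the chaining of the complement of `y`.
  obtain ⟨v, hv⟩ : ∃ v, v ∉ Y ∪ Y.biUnion B := by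
    by_contra hn
    push Not at hn
    rw [Finset.eq_univ_of_forall hn, Finset.card_univ] at hB
    exact lt_irrefl _ hB
  rw [Finset.mem_union, not_or, Finset.mem_biUnion] at hv
  obtain ⟨hvY, hvB⟩ := hv
  push Not at hvB
  have hA : ∀ y ∈ Y, 2 * m ≤ (A y v).card := by
    intro y hy
    have := hvB y hy
    simp only [B, Finset.mem_filter, Finset.mem_univ, true_and, not_and, not_lt] at this
    exact this fun e => hvY (e ▸ hy)
  have hTex : ∀ y, ∃ T : Finset M, y ∈ Y → T ⊆ A y v ∧ T.card = 2 * m ∧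
      ∀ t ∈ T, ∀ s ∈ A y v, s ∉ T → p y t ≤ p y s := by
    intro y
    by_cases hy : y ∈ Y
    · obtain ⟨T, hT⟩ := exists_lower_subset (p y) (A y v) (2 * m) (hA y hy)
      exact ⟨T, fun _ => hT⟩
    · exact ⟨∅, fun h => absurd h hy⟩
  choose T hT using hTex
  -- The point `v` with the next `2 * m` elements above it: a convex piece with enough room to move
  -- up to `2 * m` entries off `v`.
  let W : M → Finset M := fun y => insert v (T y)
  have hTmem : ∀ y ∈ Y, ∀ t ∈ T y, t ≠ y ∧ f y t = f y v ∧ p y v < p y t := by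
    intro y hy t ht
    simpa [A] using (hT y hy).1 ht
  have hWcard : ∀ y ∈ Y, (W y).card = 2 * m + 1 := by
    intro y hy
    rw [Finset.card_insert_of_notMem (fun h => lt_irrefl _ (hTmem y hy v h).2.2), (hT y hy).2.1]
  have hyW : ∀ y ∈ Y, y ∉ W y := by
    intro y hy h
    rcases Finset.mem_insert.1 h with h | h
    · exact hvY (h ▸ hy)
    · exact (hTmem y hy y h).1 rfl
  have hWcol : ∀ y ∈ Y, ∀ x ∈ W y, f y x = f y v := by
    intro y hy x hx
    rcases Finset.mem_insert.1 hx with rfl | hx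
    · rfl
    · exact (hTmem y hy x hx).2.1
  have hWconv : ∀ y ∈ Y, ∀ z ∉ W y, z ≠ y → f y z = f y v →
      (∀ x ∈ W y, p y z < p y x) ∨ (∀ x ∈ W y, p y x < p y z) := by
    intro y hy z hz hzy hzv
    rw [Finset.mem_insert, not_or] at hz
    have hne : p y z ≠ p y v := fun e => hz.1 ((hc y).inj z hzy v (fun e => hvY (e ▸ hy)) hzv e)
    rcases lt_or_gt_of_ne hne with hlt | hgt
    · left
      intro x hx
      rcases Finset.mem_insert.1 hx with rfl | hx
      · exact hlt
      · exact hlt.trans (hTmem y hy x hx).2.2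
    · right
      intro x hx
      rcases Finset.mem_insert.1 hx with rfl | hx
      · exact hgt
      · refine lt_of_le_of_ne ((hT y hy).2.2 x hx z (by simp [A, hzy, hzv, hgt]) hz.2) fun e => ?_
        obtain ⟨h1, h2, -⟩ := hTmem y hy x hx
        exact hz.2 ((hc y).inj x h1 z hzy (h2.trans hzv.symm) e ▸ hx)
  let E : Finset M := Y.biUnion W
  have hWE : ∀ y ∈ Y, ∀ x ∈ W y, x ∈ E := fun y hy x hx => Finset.mem_biUnion.2 ⟨y, hy, hx⟩
  have hvE : v ∈ E := by
    obtain ⟨y, hy⟩ : Y.Nonempty := by rw [← Finset.card_pos]; omega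
    exact hWE y hy v (Finset.mem_insert_self _ _)
  have hEcard : E.card ≤ (2 * m + 1) * (2 * m + 1) := by
    have := Finset.card_biUnion_le_card_mul Y W (2 * m + 1) fun y hy => (hWcard y hy).le
    rwa [hY] at this
  have hinj : ∀ x ≠ v, ∀ y ≠ v, f v x = f v y → p v x = p v y → x = y :=
    fun x hx y hy => (hc v).inj x hx y hy
  -- The chaining of the complement of `v`, refined by `E`, will chain everything: tuples through
  -- `v` are first shifted off `v`, using the chaining for some `y₀ ∈ Y`.
  let F := cutColor E v (f v) (p v)
  have hFmem : ∀ {x y}, x ∈ E → (F x = F y ↔ x = y) := fun hx => cutColor_eq_iff_of_mem hx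
  have hchain : IsChaining L F (p v) Set.univ := by
    refine ⟨fun x _ y _ hxy hp => ?_, fun a r x y _ _ hxy => ?_⟩
    · by_cases hx : x ∈ E
      · exact (hFmem hx).1 hxy
      · have := (cutColor_eq_iff_of_notMem hx).1 hxy
        exact hinj x (fun e => hx (e ▸ hvE)) y (fun e => this.1 (e ▸ hvE)) this.2.1 hp
    · have hxyE : ∀ i, x i ∈ E ∨ y i ∈ E → x i = y i := by
        rintro i (hi | hi)
        · exact (hFmem hi).1 (hxy.color i)
        · exact ((hFmem hi).1 (hxy.color i).symm).symm
      let Z : Finset M := Finset.univ.image x ∪ Finset.univ.image y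
      have hxZ : ∀ i, x i ∈ Z := fun i =>
        Finset.mem_union_left _ (Finset.mem_image_of_mem _ (Finset.mem_univ i))
      have hyZ : ∀ i, y i ∈ Z := fun i =>
        Finset.mem_union_right _ (Finset.mem_image_of_mem _ (Finset.mem_univ i))
      have hZcard : Z.card ≤ 2 * m := by
        have h1 := Finset.card_union_le (Finset.univ.image x) (Finset.univ.image y)
        have h2 := (Finset.card_image_le (f := x) (s := Finset.univ))
        have h3 := (Finset.card_image_le (f := y) (s := Finset.univ))
        rw [Finset.card_univ, Fintype.card_fin] at h2 h3
        have h4 := hm a r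
        change (Finset.univ.image x ∪ Finset.univ.image y).card ≤ _
        omega
      obtain ⟨y₀, hy₀, hy₀Z⟩ : ∃ y₀ ∈ Y, y₀ ∉ Z := by
        by_contra hn
        push Not at hn
        have := Finset.card_le_card (s := Y) (t := Z) hn
        omega
      obtain ⟨σ, hσout, hσin, hσv, hσrel⟩ := exists_shift (hc y₀) (W y₀) Z
        (Finset.mem_insert_self _ _) (hyW y₀ hy₀) hy₀Z (hWcol y₀ hy₀) (hWconv y₀ hy₀)
        (by rw [hWcard y₀ hy₀]; omega)
      rw [← hσrel a r x hxZ, ← hσrel a r y hyZ]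
      have hσE : ∀ z ∈ Z, σ z ∉ E → z ∉ W y₀ := fun z hz h hzW =>
        h (hWE y₀ hy₀ _ (hσin z hz hzW))
      -- Only points of `W y₀ ⊆ E` move. Their colors are singletons, so the two tuples coincide at
      -- such entries and move together.
      have hσF : ∀ i, F (σ (x i)) = F (σ (y i)) := by
        intro i
        by_cases hi : x i ∈ W y₀ ∨ y i ∈ W y₀
        · rw [hxyE i (hi.imp (hWE y₀ hy₀ _) (hWE y₀ hy₀ _))]
        · rw [not_or] at hi
          rw [hσout _ hi.1, hσout _ hi.2]
          exact hxy.color i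
      refine (hc v).rel a r _ _ (fun i => hσv _ (hxZ i)) (fun i => hσv _ (hyZ i))
        (SamePattern.of_cutColor hinj (fun i => hσv _ (hxZ i)) (fun i => hσv _ (hyZ i))
          ⟨hσF, fun i j hij => ?_⟩)
      change F (σ (x i)) = F (σ (x j)) at hij
      simp only [Function.comp_apply]
      have hij' : F (σ (y i)) = F (σ (y j)) := (hσF i).symm.trans (hij.trans (hσF j))
      by_cases hi : σ (x i) ∈ E
      · have h1 := (hFmem hi).1 hij
        have h2 : σ (x i) = σ (y i) := (hFmem hi).1 (hσF i)
        have h3 : σ (y i) = σ (y j) := (hFmem (h2 ▸ hi)).1 hij'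
        rw [← h1, ← h3]
        simp
      · have hj : σ (x j) ∉ E := fun h => hi ((hFmem h).1 hij.symm ▸ h)
        have hi' : σ (y i) ∉ E := fun h => hi ((hFmem h).1 (hσF i).symm ▸ h)
        have hj' : σ (y j) ∉ E := fun h => hj ((hFmem h).1 (hσF j).symm ▸ h)
        rw [hσout _ (hσE _ (hxZ i) hi), hσout _ (hσE _ (hxZ j) hj),
          hσout _ (hσE _ (hyZ i) hi'), hσout _ (hσE _ (hyZ j) hj')]
        rw [hσout _ (hσE _ (hxZ i) hi), hσout _ (hσE _ (hxZ j) hj)] at hij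
        exact hxy.order i j hij
  refine hchain.chainable _ (fun x _ => cutColor_mem (k := k) fun hx =>
    hf v x (fun e => hx (e ▸ hvE))) ((card_cutColor_codomain_le E k).trans ?_)
  exact add_le_add hEcard (Nat.mul_le_mul_left _ (by omega))

end Extension

/-! ### Well-quasi-order for chainable structures and locality of chainability. -/

section WellQuasiOrder

variable {L : FirstOrder.Language.{u, v}} [L.IsRelational]

/-- The colors of a tuple, together with the order of its entries of equal color. -/
def pattern {M κ : Type*} (f : M → κ) (p : M → ℕ) {a : ℕ} (x : Fin a → M) :
    (Fin a → κ) × (Fin a → Fin a → Prop) :=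
  (f ∘ x, fun i j => f (x i) = f (x j) ∧ p (x i) < p (x j))

theorem pattern_eq_iff {M N κ : Type*} {f : M → κ} {p : M → ℕ} {g : N → κ} {q : N → ℕ} {a : ℕ}
    {x : Fin a → M} {y : Fin a → N} : pattern f p x = pattern g q y ↔ SamePattern f p g q x y := by
  constructor
  · intro h
    have h1 : ∀ i, f (x i) = g (y i) := fun i => congrFun (congrArg Prod.fst h) i
    refine ⟨h1, fun i j hij => ?_⟩
    have h2 : (f (x i) = f (x j) ∧ p (x i) < p (x j)) = (g (y i) = g (y j) ∧ q (y i) < q (y j)) :=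
      congrFun (congrFun (congrArg Prod.snd h) i) j
    rwa [← h1 i, ← h1 j, and_iff_right hij, and_iff_right hij, eq_iff_iff] at h2
  · intro h
    refine Prod.ext (funext h.color) (funext fun i => funext fun j => propext ?_)
    change (f (x i) = f (x j) ∧ p (x i) < p (x j)) ↔ (g (y i) = g (y j) ∧ q (y i) < q (y j))
    rw [← h.color, ← h.color]
    exact and_congr_right fun hij => h.order i j hij

theorem exists_lt_nonempty_embedding_of_chainable [Finite (Σ n : ℕ, L.Relations n)] {k : ℕ}
    (R : ℕ → Bundled.{w} L.Structure) (hfin : ∀ n, Finite (R n))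
    (h : ∀ n, Chainable L k (Set.univ : Set (R n))) :
    ∃ i j, i < j ∧ Nonempty (R i ↪[L] R j) := by
  classical
  have : ∀ n, ∃ (f : R n → Fin k) (p : R n → ℕ), IsChaining L f p Set.univ := by
    intro n
    obtain ⟨f, p, hf, hc⟩ := h n
    refine ⟨fun x => ⟨f x, hf x trivial⟩, p, fun x hx y hy hxy =>
      hc.inj x hx y hy (congrArg Fin.val hxy), fun a r x y hx hy hxy =>
      hc.rel a r x y hx hy ⟨fun i => congrArg Fin.val (hxy.color i), fun i j hij =>
        hxy.order i j (Fin.ext hij)⟩⟩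
  choose f p hc using this
  have hft : ∀ n, Fintype (R n) := fun n => Fintype.ofFinite _
  -- A chained structure is coded by the patterns on which each relation holds and by the sizes of
  -- its colors. There are finitely many such pattern tables, and Dickson's lemma handles the sizes.
  let τ : ℕ → ∀ s : Σ a, L.Relations a, Set ((Fin s.1 → Fin k) × (Fin s.1 → Fin s.1 → Prop)) :=
    fun n s => pattern (f n) (p n) '' {x | RelMap s.2 x}
  let size : ℕ → Fin k → ℕ := fun n c => (Finset.univ.filter (f n · = c)).card
  obtain ⟨i, j, hij, hτ, hsize⟩ :=
    ((Finite.wellQuasiOrdered (α := ∀ s : Σ a, L.Relations a,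
      Set ((Fin s.1 → Fin k) × (Fin s.1 → Fin s.1 → Prop))) (· = ·)).prod
      (wellQuasiOrdered_le (α := Fin k → ℕ))) fun n => (τ n, size n)
  refine ⟨i, j, hij, ?_⟩
  have hrel : ∀ (n n' : ℕ), τ n = τ n' → ∀ (a : ℕ) (r : L.Relations a) (x : Fin a → R n)
      (y : Fin a → R n'), SamePattern (f n) (p n) (f n') (p n') x y → RelMap r x → RelMap r y := by
    intro n n' hnn a r x y hxy hx
    have h1 : pattern (f n) (p n) x ∈ τ n ⟨a, r⟩ := ⟨x, hx, rfl⟩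
    rw [hnn] at h1
    obtain ⟨z, hz, hzx⟩ := h1
    exact (hc n').rel a r z y (fun _ => trivial) (fun _ => trivial)
      ((pattern_eq_iff.1 hzx).trans hxy) hz
  obtain ⟨e⟩ := nonempty_embedding_of_counts (L := L) (f i) (f j) (p i) (p j) Finset.univ
    Finset.univ (fun x _ y _ => (hc i).inj x trivial y trivial)
    (fun x _ y _ => (hc j).inj x trivial y trivial) hsize
    (fun a r x y _ _ hxy => ⟨hrel j i hτ.symm a r y x hxy.symm, hrel i j hτ a r x y hxy⟩)
  let e₀ : R i ↪[L] restriction L ((Finset.univ : Finset (R i)) : Set (R i)) :=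
    embeddingOfInjective (fun x => ⟨x, Finset.mem_coe.2 (Finset.mem_univ x)⟩)
      (fun x y hxy => congrArg Subtype.val hxy) (fun a r x => Iff.rfl)
  exact ⟨((restrictionEmbedding _).comp e).comp e₀⟩

/-- Every finite structure without a chaining with `k` colors contains one all of whose proper
subsets are chainable with `k` colors. -/
theorem exists_minimal_not_chainable {k q : ℕ} {M : Type w} [L.Structure M] [Finite M]
    (hloc : ∀ s : Finset M, s.card ≤ q → Chainable L k (s : Set M))
    (h : ¬ Chainable L k (Set.univ : Set M)) :
    ∃ N : Bundled.{w} L.Structure, Finite N ∧ q < Nat.card N ∧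
      ¬ Chainable L k (Set.univ : Set N) ∧ ∀ y : N, Chainable L k ({y}ᶜ : Set N) := by
  classical
  have := Fintype.ofFinite M
  -- A non-chainable subset of least size; it exceeds `q` by `hloc`.
  obtain ⟨s, hs, hmin⟩ := Finset.exists_min_image
    (Finset.univ.filter fun s : Finset M => ¬ Chainable L k (s : Set M)) Finset.card
    ⟨Finset.univ, by simpa using h⟩
  simp only [Finset.mem_filter, Finset.mem_univ, true_and] at hs hmin
  refine ⟨⟨restriction L (s : Set M), inferInstance⟩, inferInstanceAs (Finite (s : Set M)), ?_, ?_,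
    ?_⟩
  · have : Nat.card (restriction L (s : Set M)) = s.card := Set.ncard_coe_finset s
    rw [this]
    by_contra hq
    exact hs (hloc s (not_lt.1 hq))
  · rwa [chainable_restriction_iff]
  · rintro ⟨y, hy⟩
    rw [← chainable_image_iff (restrictionEmbedding (s : Set M))]
    have : Chainable L k ((s.erase y : Finset M) : Set M) := by
      by_contra hn
      have := hmin _ hn
      have := Finset.card_erase_lt_of_mem (Finset.mem_coe.1 hy)
      omega
    refine this.mono ?_ le_rfl
    rintro _ ⟨⟨x, hx⟩, hxy, rfl⟩
    rw [Finset.mem_coe, Finset.mem_erase]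
    exact ⟨fun e => hxy (Subtype.ext e), hx⟩

/-- Chainability with `k` colors of a finite structure is determined by the subsets of bounded
size. -/
theorem exists_chainable_local_bound (L : FirstOrder.Language.{u, v}) [L.IsRelational]
    [Finite (Σ n : ℕ, L.Relations n)] (k : ℕ) :
    ∃ q : ℕ, ∀ (M : Type w) [L.Structure M] [Finite M],
      (∀ s : Finset M, s.card ≤ q → Chainable L k (s : Set M)) →
        Chainable L k (Set.univ : Set M) := by
  obtain ⟨m, hm⟩ := exists_arity_bound L
  by_contra hcon
  push Not at hcon
  have hN : ∀ q : ℕ, ∃ N : Bundled.{w} L.Structure, Finite N ∧ q < Nat.card N ∧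
      ¬ Chainable L k (Set.univ : Set N) ∧ ∀ y : N, Chainable L k ({y}ᶜ : Set N) := by
    intro q
    obtain ⟨M, _, _, hloc, h⟩ := hcon q
    exact exists_minimal_not_chainable hloc h
  choose N hNfin hNcard hNnot hN using hN
  let c := (2 * m + 1) + (2 * m + 1) * (k * (2 * m))
  -- The shift by `c` makes every structure large enough for `chainable_of_forall_compl_singleton`.
  -- Strictly increasing sizes ensure that an embedding between two terms misses a point.
  obtain ⟨φ, hφ, hcardφ⟩ := Filter.strictMono_subseq_of_tendsto_atTop
    (u := fun q => Nat.card (N (q + c)))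
    (Filter.tendsto_atTop_mono
      (fun q => (Nat.le_add_right q c).trans (hNcard (q + c)).le) Filter.tendsto_id)
  have hch : ∀ n, Chainable L ((2 * m + 1) * (2 * m + 1) + k * ((2 * m + 1) * (2 * m + 1) + 1))
      (Set.univ : Set (N (φ n + c))) := by
    intro n
    have := Fintype.ofFinite (N (φ n + c))
    refine chainable_of_forall_compl_singleton hm ?_ (hN _)
    rw [← Nat.card_eq_fintype_card]
    exact (Nat.le_add_left c _).trans_lt (hNcard _)
  obtain ⟨i, j, hij, ⟨e⟩⟩ := exists_lt_nonempty_embedding_of_chainable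
    (fun n => N (φ n + c)) (fun n => hNfin _) hch
  have hlt : Nat.card (N (φ i + c)) < Nat.card (N (φ j + c)) := hcardφ hij
  obtain ⟨y, hy⟩ : ∃ y, y ∉ Set.range e := by
    by_contra hn
    push Not at hn
    exact absurd (Nat.card_le_card_of_surjective e hn) (not_le.2 hlt)
  refine hNnot (φ i + c) ((chainable_image_iff e k _).1 ((hN _ y).mono ?_ le_rfl))
  rintro _ ⟨x, -, rfl⟩ rfl
  exact hy ⟨x, rfl⟩

end WellQuasiOrder

/-! ### Finite Ramsey theorem and splitting of homogeneous sets. -/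

section Ramsey

/-- In the inductive step of Ramsey's theorem: there is a large subset on which the color of a set
depends only on its least element. -/
theorem exists_color_min_of_ramsey {κ : Type*} {d : ℕ}
    (ih : ∀ h : ℕ, ∃ n, ∀ S : Finset ℕ, n ≤ S.card → ∀ c : Finset ℕ → κ, ∃ T ⊆ S, T.card = h ∧
      ∀ t ⊆ T, ∀ t' ⊆ T, t.card = d → t'.card = d → c t = c t') (l : ℕ) :
    ∃ n, ∀ S : Finset ℕ, n ≤ S.card → ∀ c : Finset ℕ → κ, ∃ T ⊆ S, T.card = l ∧
      ∃ col : ℕ → κ, ∀ x t, insert x t ⊆ T → t.card = d → (∀ y ∈ t, x < y) →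
        c (insert x t) = col x := by
  classical
  induction l with
  | zero =>
    refine ⟨0, fun S _ c => ⟨∅, Finset.empty_subset _, rfl, fun _ => c ∅, ?_⟩⟩
    intro x t hxt
    exact absurd (hxt (Finset.mem_insert_self x t)) (Finset.notMem_empty x)
  | succ l ihl =>
    obtain ⟨n, hn⟩ := ihl
    obtain ⟨n', hn'⟩ := ih n
    refine ⟨n' + 1, fun S hS c => ?_⟩
    have hne : S.Nonempty := by rw [← Finset.card_pos]; omega
    let x₀ := S.min' hne
    have hx₀ : x₀ ∈ S := S.min'_mem hne
    -- The least point `x₀` is set aside and the rest thinned until all `d`-sets get one color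
    -- together with `x₀`; the thinned set still has the `n` points needed to continue.
    obtain ⟨T', hT'S, hT', hhom⟩ := hn' (S.erase x₀)
      (by rw [Finset.card_erase_of_mem hx₀]; omega) (fun t => c (insert x₀ t))
    obtain ⟨T, hTT', hT, col, hcol⟩ := hn T' hT'.ge c
    have hTS : T ⊆ S.erase x₀ := hTT'.trans hT'S
    have hlt : ∀ y ∈ T, x₀ < y := fun y hy => by
      have := Finset.mem_erase.1 (hTS hy)
      exact lt_of_le_of_ne (S.min'_le y this.2) this.1.symm
    obtain ⟨v, hv⟩ : ∃ v, ∀ t ⊆ T', t.card = d → c (insert x₀ t) = v := by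
      by_cases h : ∃ t ⊆ T', t.card = d
      · obtain ⟨t₀, ht₀, ht₀d⟩ := h
        exact ⟨c (insert x₀ t₀), fun t ht htd => hhom t ht t₀ ht₀ htd ht₀d⟩
      · exact ⟨c ∅, fun t ht htd => absurd ⟨t, ht, htd⟩ h⟩
    refine ⟨insert x₀ T, Finset.insert_subset hx₀ (hTS.trans (Finset.erase_subset _ _)), ?_,
      Function.update col x₀ v, ?_⟩
    · rw [Finset.card_insert_of_notMem fun h => lt_irrefl _ (hlt _ h), hT]
    · intro x t hxt htd hxy
      have hmem : ∀ y ∈ t, y ∈ T := by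
        intro y hy
        refine Finset.mem_of_mem_insert_of_ne (hxt (Finset.mem_insert_of_mem hy)) ?_
        rintro rfl
        have h1 := hxy _ hy
        rcases Finset.mem_insert.1 (hxt (Finset.mem_insert_self x t)) with h2 | h2
        · exact absurd h2 h1.ne
        · exact lt_asymm h1 (hlt x h2)
      by_cases hx : x = x₀
      · subst hx
        rw [Function.update_self]
        exact hv t (fun y hy => hTT' (hmem y hy)) htd
      · rw [Function.update_of_ne hx]
        refine hcol x t (Finset.insert_subset ?_ hmem) htd hxy
        exact Finset.mem_of_mem_insert_of_ne (hxt (Finset.mem_insert_self x t)) hx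

/-- The finite Ramsey theorem. -/
theorem exists_ramsey_number (κ : Type*) [Finite κ] (d h : ℕ) :
    ∃ n, ∀ S : Finset ℕ, n ≤ S.card → ∀ c : Finset ℕ → κ, ∃ T ⊆ S, T.card = h ∧
      ∀ t ⊆ T, ∀ t' ⊆ T, t.card = d → t'.card = d → c t = c t' := by
  classical
  have := Fintype.ofFinite κ
  induction d generalizing h with
  | zero =>
    refine ⟨h, fun S hS c => ?_⟩
    obtain ⟨T, hTS, hT⟩ := Finset.exists_subset_card_eq hS
    refine ⟨T, hTS, hT, fun t _ t' _ ht ht' => ?_⟩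
    rw [Finset.card_eq_zero.1 ht, Finset.card_eq_zero.1 ht']
  | succ d ih =>
    -- By pigeonhole, `h` of these points share the color that they induce as least elements.
    obtain ⟨n, hn⟩ := exists_color_min_of_ramsey ih (Fintype.card κ * h)
    refine ⟨n, fun S hS c => ?_⟩
    obtain ⟨T, hTS, hT, col, hcol⟩ := hn S hS c
    obtain ⟨v, -, hv⟩ := Finset.exists_le_card_fiber_of_mul_le_card_of_maps_to
      (s := T) (t := Finset.univ) (f := col) (n := h) (fun _ _ => Finset.mem_univ _)
      ⟨c ∅, Finset.mem_univ _⟩ (by rw [Finset.card_univ, hT])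
    obtain ⟨T', hT'T, hT'⟩ := Finset.exists_subset_card_eq hv
    have hc : ∀ t ⊆ T', t.card = d + 1 → c t = v := by
      intro t ht htd
      have hne : t.Nonempty := by rw [← Finset.card_pos]; omega
      have hmem := t.min'_mem hne
      rw [← Finset.insert_erase hmem, hcol (t.min' hne) (t.erase (t.min' hne))]
      · exact (Finset.mem_filter.1 (hT'T (ht hmem))).2
      · rw [Finset.insert_erase hmem]
        exact (ht.trans hT'T).trans (Finset.filter_subset _ _)
      · rw [Finset.card_erase_of_mem hmem, htd]
        rfl
      · exact fun y hy => Finset.min'_lt_of_mem_erase_min' t hne hy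
    refine ⟨T', (hT'T.trans (Finset.filter_subset _ _)).trans hTS, hT', ?_⟩
    intro t ht t' ht' htd htd'
    rw [hc t ht htd, hc t' ht' htd']

theorem card_image_le_of_ker_le {ι : Type*} (J : Finset ι) (α β : ι → ℕ)
    (h : ∀ i ∈ J, ∀ j ∈ J, α i = α j → β i = β j) : (J.image β).card ≤ (J.image α).card := by
  classical
  let γ : ℕ → ℕ := fun v => if hv : ∃ i ∈ J, α i = v then β hv.choose else 0
  have hγ : ∀ i ∈ J, γ (α i) = β i := by
    intro i hi
    have hv : ∃ i' ∈ J, α i' = α i := ⟨i, hi, rfl⟩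
    simp only [γ, dif_pos hv]
    exact h _ hv.choose_spec.1 _ hi hv.choose_spec.2
  have : J.image β ⊆ (J.image α).image γ := by
    intro v hv
    obtain ⟨i, hi, rfl⟩ := Finset.mem_image.1 hv
    exact Finset.mem_image.2 ⟨α i, Finset.mem_image_of_mem _ hi, hγ i hi⟩
  exact (Finset.card_le_card this).trans Finset.card_image_le

theorem card_image_eq_of_ker_eq {ι : Type*} (J : Finset ι) (α β : ι → ℕ)
    (h : ∀ i ∈ J, ∀ j ∈ J, (α i = α j ↔ β i = β j)) : (J.image α).card = (J.image β).card :=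
  le_antisymm (card_image_le_of_ker_le J β α fun i hi j hj => (h i hi j hj).2)
    (card_image_le_of_ker_le J α β fun i hi j hj => (h i hi j hj).1)

/-- A finite set of natural numbers splits into consecutive pieces of size `q` followed by `m`
further elements. -/
theorem exists_consecutive_pieces (k q m : ℕ) (T : Finset ℕ) (hT : T.card = k * q + m) :
    ∃ (A : ℕ → Finset ℕ) (P : Finset ℕ), (∀ b < k, A b ⊆ T ∧ (A b).card = q) ∧ P ⊆ T ∧
      P.card = m ∧ (∀ b < k, ∀ b' < k, b < b' → ∀ x ∈ A b, ∀ y ∈ A b', x < y) ∧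
      ∀ b < k, ∀ x ∈ A b, ∀ y ∈ P, x < y := by
  let w : ℕ → ℕ := fun i => if h : i < k * q + m then T.orderEmbOfFin hT ⟨i, h⟩ else 0
  have hw : ∀ i j, i < j → j < k * q + m → w i < w j := by
    intro i j hij hj
    simp only [w, dif_pos hj, dif_pos (hij.trans hj)]
    exact (T.orderEmbOfFin hT).strictMono hij
  have hwT : ∀ i < k * q + m, w i ∈ T := by
    intro i hi
    simp only [w, dif_pos hi]
    exact Finset.orderEmbOfFin_mem T hT _
  have hinj : ∀ i < k * q + m, ∀ j < k * q + m, w i = w j → i = j := by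
    intro i hi j hj hij
    rcases lt_trichotomy i j with h | h | h
    · exact absurd hij (hw i j h hj).ne
    · exact h
    · exact absurd hij (hw j i h hi).ne'
  have hb : ∀ b < k, ∀ i < q, b * q + i < k * q := by
    intro b hb i hi
    have : (b + 1) * q ≤ k * q := Nat.mul_le_mul_right q hb
    rw [add_mul, one_mul] at this
    omega
  refine ⟨fun b => (Finset.range q).image fun i => w (b * q + i),
    (Finset.range m).image fun i => w (k * q + i), ?_, ?_, ?_, ?_, ?_⟩
  · intro b hbk
    constructor
    · intro x hx
      obtain ⟨i, hi, rfl⟩ := Finset.mem_image.1 hx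
      have := hb b hbk i (Finset.mem_range.1 hi)
      exact hwT _ (by omega)
    · rw [Finset.card_image_of_injOn, Finset.card_range]
      intro i hi j hj hij
      have h1 := hb b hbk i (by simpa using hi)
      have h2 := hb b hbk j (by simpa using hj)
      have := hinj _ (by omega) _ (by omega) hij
      omega
  · intro x hx
    obtain ⟨i, hi, rfl⟩ := Finset.mem_image.1 hx
    rw [Finset.mem_range] at hi
    exact hwT _ (by omega)
  · rw [Finset.card_image_of_injOn, Finset.card_range]
    intro i hi j hj hij
    simp only [Finset.coe_range, Set.mem_Iio] at hi hj
    have := hinj _ (by omega) _ (by omega) hij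
    omega
  · intro b hbk b' hbk' hbb x hx y hy
    obtain ⟨i, hi, rfl⟩ := Finset.mem_image.1 hx
    obtain ⟨j, hj, rfl⟩ := Finset.mem_image.1 hy
    rw [Finset.mem_range] at hi hj
    have h1 := hb b' hbk' j hj
    have h2 : (b + 1) * q ≤ b' * q := Nat.mul_le_mul_right q hbb
    rw [add_mul, one_mul] at h2
    exact hw _ _ (by omega) (by omega)
  · intro b hbk x hx y hy
    obtain ⟨i, hi, rfl⟩ := Finset.mem_image.1 hx
    obtain ⟨j, hj, rfl⟩ := Finset.mem_image.1 hy
    rw [Finset.mem_range] at hi hj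
    have h1 := hb b hbk i hi
    exact hw _ _ (by omega) (by omega)

end Ramsey

/-! ### Jointly indiscernible subsequences. -/

section Indiscernible

/-- The color of an index: indices in the first summand are their own colors. -/
def indexColor {e k : ℕ} : Fin e ⊕ (Fin k × ℕ) → Fin e ⊕ Fin k := Sum.map id Prod.fst

/-- The position of an index. -/
def indexPos {e k : ℕ} : Fin e ⊕ (Fin k × ℕ) → ℕ := Sum.elim (fun _ => 0) Prod.snd

/-- Tuples of indices with the same pattern, whose positions in distinct colors are ordered by
color and below all elements of `P`, have the same ranks in suitable sets of size `m`. -/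
theorem exists_common_ranks {e k m a : ℕ} (ha : a ≤ m) (A : Fin k → Finset ℕ) (P : Finset ℕ)
    (hP : P.card = m) (hA : ∀ b b', b < b' → ∀ i ∈ A b, ∀ j ∈ A b', i < j)
    (hAP : ∀ b, ∀ i ∈ A b, ∀ j ∈ P, i < j) (x y : Fin a → Fin e ⊕ (Fin k × ℕ))
    (hx : ∀ j b i, x j = Sum.inr (b, i) → i ∈ A b) (hy : ∀ j b i, y j = Sum.inr (b, i) → i ∈ A b)
    (hxy : SamePattern indexColor indexPos indexColor indexPos x y) :
    ∃ t t' : Finset ℕ, t.card = m ∧ t'.card = m ∧ (∀ i ∈ t, i ∈ P ∨ ∃ b, i ∈ A b) ∧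
      (∀ i ∈ t', i ∈ P ∨ ∃ b, i ∈ A b) ∧
      ∀ j, (∃ z, x j = Sum.inl z ∧ y j = Sum.inl z) ∨
        ∃ (b : Fin k) (n : Fin m), x j = Sum.inr (b, Nat.nth (· ∈ t) n) ∧
          y j = Sum.inr (b, Nat.nth (· ∈ t') n) := by
  classical
  have hcases : ∀ j, (∃ z, x j = Sum.inl z ∧ y j = Sum.inl z) ∨
      ∃ b i i', x j = Sum.inr (b, i) ∧ y j = Sum.inr (b, i') := by
    intro j
    have h := hxy.color j
    rcases hxj : x j with z | ⟨b, i⟩ <;> rcases hyj : y j with z' | ⟨b', i'⟩ <;>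
      simp only [hxj, hyj, indexColor, Sum.map_inl, Sum.map_inr, id_eq, Sum.inl.injEq,
        Sum.inr.injEq, reduceCtorEq] at h
    · exact Or.inl ⟨z, rfl, by rw [h]⟩
    · exact Or.inr ⟨b, i, i', rfl, by rw [h]⟩
  let J : Finset (Fin a) := Finset.univ.filter fun j => ∃ b i, x j = Sum.inr (b, i)
  have hJ : ∀ j ∈ J, ∃ b, x j = Sum.inr (b, indexPos (x j)) ∧ y j = Sum.inr (b, indexPos (y j)) ∧
      indexPos (x j) ∈ A b ∧ indexPos (y j) ∈ A b := by
    intro j hj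
    obtain ⟨b, i, hbi⟩ := (Finset.mem_filter.1 hj).2
    rcases hcases j with ⟨z, hz, -⟩ | ⟨b', i₁, i₂, h1, h2⟩
    · rw [hbi] at hz
      exact absurd hz (by simp)
    · refine ⟨b', ?_, ?_, ?_, ?_⟩
      · rw [h1]; rfl
      · rw [h2]; rfl
      · rw [h1]; exact hx j _ _ h1
      · rw [h2]; exact hy j _ _ h2
  -- Inside a color the order is part of the pattern; across colors it is forced by the succession
  -- of the sets `A b`.
  have horder : ∀ j ∈ J, ∀ j' ∈ J,
      (indexPos (x j) < indexPos (x j') ↔ indexPos (y j) < indexPos (y j')) := by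
    intro j hj j' hj'
    obtain ⟨b, h1, h2, h3, h4⟩ := hJ j hj
    obtain ⟨b', h1', h2', h3', h4'⟩ := hJ j' hj'
    rcases lt_trichotomy b b' with hb | rfl | hb
    · exact iff_of_true (hA b b' hb _ h3 _ h3') (hA b b' hb _ h4 _ h4')
    · refine hxy.order j j' ?_
      rw [h1, h1']
      rfl
    · exact iff_of_false (lt_asymm (hA b' b hb _ h3' _ h3)) (lt_asymm (hA b' b hb _ h4' _ h4))
  have hker : ∀ j ∈ J, ∀ j' ∈ J,
      (indexPos (x j) = indexPos (x j') ↔ indexPos (y j) = indexPos (y j')) := by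
    intro j hj j' hj'
    have h1 := horder j hj j' hj'
    have h2 := horder j' hj' j hj
    omega
  let I := J.image fun j => indexPos (x j)
  let I' := J.image fun j => indexPos (y j)
  have hII' : I.card = I'.card := card_image_eq_of_ker_eq J _ _ hker
  have hIm : I.card ≤ m := by
    refine Finset.card_image_le.trans ((Finset.card_le_univ J).trans ?_)
    rwa [Fintype.card_fin]
  -- Padding from `P` brings both index sets to size exactly `m`; as it lies above all indices used,
  -- it does not affect their ranks.
  obtain ⟨Q, hQP, hQ⟩ := Finset.exists_subset_card_eq (s := P) (n := m - I.card) (by omega)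
  have hIA : ∀ i ∈ I, ∃ b, i ∈ A b := by
    intro i hi
    obtain ⟨j, hj, rfl⟩ := Finset.mem_image.1 hi
    obtain ⟨b, -, -, h, -⟩ := hJ j hj
    exact ⟨b, h⟩
  have hIA' : ∀ i ∈ I', ∃ b, i ∈ A b := by
    intro i hi
    obtain ⟨j, hj, rfl⟩ := Finset.mem_image.1 hi
    obtain ⟨b, -, -, -, h⟩ := hJ j hj
    exact ⟨b, h⟩
  have hlt : ∀ i, (∃ b, i ∈ A b) → ∀ z ∈ Q, i < z := fun i ⟨b, hb⟩ z hz => hAP b i hb z (hQP hz)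
  have hcard : ∀ B : Finset ℕ, (∀ i ∈ B, ∃ b, i ∈ A b) → B.card = I.card →
      (B ∪ Q).card = m := by
    intro B hB hBc
    rw [Finset.card_union_of_disjoint, hBc, hQ]
    · omega
    · rw [Finset.disjoint_left]
      exact fun i hi hiQ => lt_irrefl i (hlt i (hB i hi) i hiQ)
  have hmem : ∀ B : Finset ℕ, (∀ i ∈ B, ∃ b, i ∈ A b) →
      ∀ i ∈ B ∪ Q, i ∈ P ∨ ∃ b, i ∈ A b := by
    intro B hB i hi
    rcases Finset.mem_union.1 hi with h | h
    · exact Or.inr (hB i h)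
    · exact Or.inl (hQP h)
  have hcount : ∀ (z : Fin a → Fin e ⊕ (Fin k × ℕ)), ∀ j, (∃ b, indexPos (z j) ∈ A b) →
      Nat.count (· ∈ J.image (fun j' => indexPos (z j')) ∪ Q) (indexPos (z j)) =
        ((J.filter fun j' => indexPos (z j') < indexPos (z j)).image
          fun j' => indexPos (z j')).card := by
    intro z j hj
    rw [Nat.count_eq_card_filter_range]
    congr 1
    ext i
    simp only [Finset.mem_filter, Finset.mem_range, Finset.mem_union, Finset.mem_image]
    constructor
    · rintro ⟨hi, ⟨j', hj', rfl⟩ | hiQ⟩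
      · exact ⟨j', ⟨hj', hi⟩, rfl⟩
      · exact absurd hi (lt_asymm (hlt _ hj i hiQ))
    · rintro ⟨j', ⟨hj', hi⟩, rfl⟩
      exact ⟨hi, Or.inl ⟨j', hj', rfl⟩⟩
  have hcardt := hcard I hIA rfl
  refine ⟨I ∪ Q, I' ∪ Q, hcardt, hcard I' hIA' hII'.symm, hmem I hIA, hmem I' hIA', ?_⟩
  intro j
  by_cases hj : j ∈ J
  · right
    obtain ⟨b, h1, h2, h3, h4⟩ := hJ j hj
    have hI : indexPos (x j) ∈ I ∪ Q :=
      Finset.mem_union_left _ (Finset.mem_image_of_mem (fun j => indexPos (x j)) hj)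
    have hI' : indexPos (y j) ∈ I' ∪ Q :=
      Finset.mem_union_left _ (Finset.mem_image_of_mem (fun j => indexPos (y j)) hj)
    have hcnt : Nat.count (· ∈ I ∪ Q) (indexPos (x j)) =
        Nat.count (· ∈ I' ∪ Q) (indexPos (y j)) := by
      rw [hcount x j ⟨b, h3⟩, hcount y j ⟨b, h4⟩]
      have : (J.filter fun j' => indexPos (x j') < indexPos (x j)) =
          J.filter fun j' => indexPos (y j') < indexPos (y j) :=
        Finset.filter_congr fun j' hj' => horder j' hj' j hj
      rw [this]
      exact card_image_eq_of_ker_eq _ _ _ fun i hi i' hi' =>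
        hker i (Finset.mem_filter.1 hi).1 i' (Finset.mem_filter.1 hi').1
    have hltm : Nat.count (· ∈ I ∪ Q) (indexPos (x j)) < m := by
      rw [← hcardt, Nat.count_eq_card_filter_range]
      apply Finset.card_lt_card
      rw [Finset.ssubset_iff_of_subset]
      · exact ⟨_, hI, by simp⟩
      · intro i hi
        exact (Finset.mem_filter.1 hi).2
    refine ⟨b, ⟨_, hltm⟩, ?_, ?_⟩
    · rw [Nat.nth_count (p := (· ∈ I ∪ Q)) hI]
      exact h1
    · change y j = Sum.inr (b, Nat.nth (· ∈ I' ∪ Q) (Nat.count (· ∈ I ∪ Q) (indexPos (x j))))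
      rw [hcnt, Nat.nth_count (p := (· ∈ I' ∪ Q)) hI']
      exact h2
  · left
    rcases hcases j with h | ⟨b, i, i', h, -⟩
    · exact h
    · exact absurd (Finset.mem_filter.2 ⟨Finset.mem_univ j, b, i, h⟩) hj

/-- From long sequences `g b` in a structure, one can extract subsequences of length `q` that are
jointly indiscernible over the points `ε`. -/
theorem exists_indiscernible_bound (L : FirstOrder.Language.{u, v})
    [Finite (Σ n : ℕ, L.Relations n)] (e k q : ℕ) :
    ∃ n : ℕ, ∀ (M : Type w) [L.Structure M] (ε : Fin e → M) (g : Fin k → ℕ → M),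
      ∃ A : Fin k → Finset ℕ, (∀ b, A b ⊆ Finset.range n ∧ (A b).card = q) ∧
        ∀ (a : ℕ) (r : L.Relations a) (x y : Fin a → Fin e ⊕ (Fin k × ℕ)),
          (∀ j b i, x j = Sum.inr (b, i) → i ∈ A b) → (∀ j b i, y j = Sum.inr (b, i) → i ∈ A b) →
          SamePattern indexColor indexPos indexColor indexPos x y →
          RelMap r (Sum.elim ε (fun z => g z.1 z.2) ∘ x) →
          RelMap r (Sum.elim ε (fun z => g z.1 z.2) ∘ y) := by
  classical
  obtain ⟨m, hm⟩ := exists_arity_bound L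
  -- An `m`-set of indices is colored by the relations among the points of `ε` and the terms of all
  -- `k` sequences at those indices. The homogeneous set consists of one piece of length `q` per
  -- sequence and `m` indices of padding.
  obtain ⟨n, hn⟩ := exists_ramsey_number
    (∀ s : Σ a, L.Relations a, Set (Fin s.1 → Fin e ⊕ (Fin k × Fin m))) m (k * q + m)
  refine ⟨n, fun M _ ε g => ?_⟩
  let pt : Finset ℕ → Fin e ⊕ (Fin k × Fin m) → M := fun t =>
    Sum.elim ε (fun z => g z.1 (Nat.nth (· ∈ t) z.2))
  obtain ⟨T, hTn, hT, hhom⟩ := hn (Finset.range n) (by simp)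
    (fun t s => {z | RelMap s.2 (pt t ∘ z)})
  obtain ⟨A, P, hA, hPT, hP, hAA, hAP⟩ := exists_consecutive_pieces k q m T hT
  refine ⟨fun b => A b, fun b => ⟨(hA b b.2).1.trans hTn, (hA b b.2).2⟩, ?_⟩
  intro a r x y hx hy hxy hrel
  obtain ⟨t, t', ht, ht', hsub, hsub', hnth⟩ := exists_common_ranks (hm a r) (fun b => A b) P hP
    (fun b b' hbb => hAA b b.2 b' b'.2 hbb) (fun b => hAP b b.2) x y hx hy hxy
  have hPA : ∀ s : Finset ℕ, (∀ i ∈ s, i ∈ P ∨ ∃ b : Fin k, i ∈ A b) → s ⊆ T := by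
    intro s hs i hi
    rcases hs i hi with h | ⟨b, h⟩
    · exact hPT h
    · exact (hA b b.2).1 h
  have hu : ∀ j, ∃ z, pt t z = Sum.elim ε (fun z => g z.1 z.2) (x j) ∧
      pt t' z = Sum.elim ε (fun z => g z.1 z.2) (y j) := by
    intro j
    rcases hnth j with ⟨z, h1, h2⟩ | ⟨b, i, h1, h2⟩
    · exact ⟨Sum.inl z, by rw [h1]; rfl, by rw [h2]; rfl⟩
    · exact ⟨Sum.inr (b, i), by rw [h1]; rfl, by rw [h2]; rfl⟩
  choose z hz hz' using hu
  have heq := congrFun (hhom t (hPA t hsub) t' (hPA t' hsub') ht ht') ⟨a, r⟩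
  have h1 : pt t ∘ z = Sum.elim ε (fun z => g z.1 z.2) ∘ x := funext hz
  have h2 : pt t' ∘ z = Sum.elim ε (fun z => g z.1 z.2) ∘ y := funext hz'
  rw [← h1] at hrel
  rw [← h2]
  have : z ∈ {z | RelMap r (pt t ∘ z)} := hrel
  rw [heq] at this
  exact this

end Indiscernible

/-! ### Separating small blocks from large ones. -/

section Scales

/-- There is a scale `s`, bounded in terms of `k` and `G`, such that none of `k` given numbers lies
strictly between `s` and `G s`. -/
theorem exists_scale (k : ℕ) (G : ℕ → ℕ) :
    ∃ S, ∀ n : Fin k → ℕ, ∃ s ≤ S, ∀ i, n i ≤ s ∨ G s ≤ n i := by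
  -- The open intervals from `σ j` to `G (σ j)` are disjoint for distinct `j`, so `k` numbers cannot
  -- meet all `k + 1` of them. The maximum keeps `σ` monotone for arbitrary `G`.
  let σ : ℕ → ℕ := fun j => Nat.rec 0 (fun _ s => max s (G s)) j
  have hσ : ∀ j, σ (j + 1) = max (σ j) (G (σ j)) := fun j => rfl
  have hmono : Monotone σ := monotone_nat_of_le_succ fun j => by
    rw [hσ]
    exact le_max_left _ _
  refine ⟨σ k, fun n => ?_⟩
  by_contra hcon
  push Not at hcon
  choose i hi using fun j : Fin (k + 1) => hcon (σ j) (hmono (Nat.lt_succ_iff.1 j.2))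
  have hlt : ∀ j j' : Fin (k + 1), j < j' → i j ≠ i j' := by
    intro j j' hjj h
    have h1 := (hi j).2
    have h2 := (hi j').1
    have h3 : σ (j + 1) ≤ σ j' := hmono (Fin.lt_def.1 hjj)
    have h4 : G (σ j) ≤ σ (j + 1) := le_max_right _ _
    rw [h] at h1
    omega
  have hinj : Function.Injective i := by
    intro j j' h
    rcases lt_trichotomy j j' with h' | h' | h'
    · exact absurd h (hlt _ _ h')
    · exact h'
    · exact absurd h.symm (hlt _ _ h')
  have := Fintype.card_le_of_injective i hinj
  simp at this

theorem exists_cover {α : Type*} [Nonempty α] (E : Finset α) (n : ℕ) (h : E.card ≤ n) :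
    ∃ ε : Fin n → α, ∀ x ∈ E, ∃ i, ε i = x := by
  refine ⟨fun i => if hi : (i : ℕ) < E.card then E.equivFin.symm ⟨i, hi⟩ else Classical.arbitrary α,
    fun x hx => ⟨⟨E.equivFin ⟨x, hx⟩, (Fin.is_lt _).trans_le h⟩, ?_⟩⟩
  simp

theorem exists_injOn_sequence {α : Type*} [Nonempty α] (E : Finset α) (n : ℕ) (h : n ≤ E.card) :
    ∃ g : ℕ → α, (∀ i < n, g i ∈ E) ∧ Set.InjOn g (Finset.range n) := by
  refine ⟨fun i => if hi : i < E.card then E.equivFin.symm ⟨i, hi⟩ else Classical.arbitrary α,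
    fun i hi => ?_, fun i hi j hj hij => ?_⟩
  · dsimp only
    rw [dif_pos (hi.trans_le h)]
    exact Finset.coe_mem _
  · have hi' : i < E.card := (by simpa using hi : i < n).trans_le h
    have hj' : j < E.card := (by simpa using hj : j < n).trans_le h
    simpa [dif_pos hi', dif_pos hj', Subtype.val_inj] using hij

end Scales

/-! ### From monomorphic decompositions to chainings. -/

section Decomposition

variable {L : FirstOrder.Language.{u, v}}

theorem chainable_of_isEmpty {M : Type*} [L.Structure M] [IsEmpty M] (k : ℕ) :
    Chainable L k (Set.univ : Set M) := by
  refine ⟨0, 0, fun x => isEmptyElim x, fun x => isEmptyElim x, fun a r x y _ _ _ h => ?_⟩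
  rwa [show y = x from funext fun i => isEmptyElim (x i)]

/-- Restricting indiscernible sequences and adding the points `ε` yields a chainable set. -/
theorem chainable_of_indiscernible {M : Type*} [L.Structure M] {e k : ℕ} (ε : Fin e → M)
    (g : Fin k → ℕ → M) (A : Fin k → Finset ℕ)
    (h : ∀ (a : ℕ) (r : L.Relations a) (x y : Fin a → Fin e ⊕ (Fin k × ℕ)),
      (∀ j b i, x j = Sum.inr (b, i) → i ∈ A b) → (∀ j b i, y j = Sum.inr (b, i) → i ∈ A b) →
      SamePattern indexColor indexPos indexColor indexPos x y →
      RelMap r (Sum.elim ε (fun z => g z.1 z.2) ∘ x) →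
      RelMap r (Sum.elim ε (fun z => g z.1 z.2) ∘ y)) :
    Chainable L (e + k) (Set.range ε ∪ {x | ∃ b, ∃ i ∈ A b, g b i = x}) := by
  classical
  let D : Set M := Set.range ε ∪ {x | ∃ b, ∃ i ∈ A b, g b i = x}
  have hex : ∀ x ∈ D, ∃ z : Fin e ⊕ (Fin k × ℕ), Sum.elim ε (fun z => g z.1 z.2) z = x ∧
      ∀ b i, z = Sum.inr (b, i) → i ∈ A b := by
    rintro x (⟨i, rfl⟩ | ⟨b, i, hi, rfl⟩)
    · exact ⟨Sum.inl i, rfl, fun b i h => absurd h (by simp)⟩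
    · refine ⟨Sum.inr (b, i), rfl, fun b' i' h => ?_⟩
      simp only [Sum.inr.injEq, Prod.mk.injEq] at h
      obtain ⟨rfl, rfl⟩ := h
      exact hi
  by_cases hne : Nonempty (Fin e ⊕ (Fin k × ℕ))
  · choose! idx hidx hidxA using hex
    have hch : IsChaining L (indexColor ∘ idx) (indexPos ∘ idx) D := by
      refine ⟨fun x hx y hy hc hp => ?_, fun a r x y hx hy hxy hr => ?_⟩
      · have : idx x = idx y := by
          simp only [Function.comp_apply, indexColor, indexPos] at hc hp
          rcases hx' : idx x with i | ⟨b, i⟩ <;> rcases hy' : idx y with i' | ⟨b', i'⟩ <;>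
            simp_all
        rw [← hidx x hx, ← hidx y hy, this]
      · have h1 : Sum.elim ε (fun z => g z.1 z.2) ∘ (idx ∘ x) = x :=
          funext fun j => hidx _ (hx j)
        have h2 : Sum.elim ε (fun z => g z.1 z.2) ∘ (idx ∘ y) = y :=
          funext fun j => hidx _ (hy j)
        rw [← h2]
        rw [← h1] at hr
        exact h a r _ _ (fun j => hidxA _ (hx j)) (fun j => hidxA _ (hy j))
          ⟨hxy.color, hxy.order⟩ hr
    refine hch.chainable Finset.univ (fun x _ => Finset.mem_univ _) ?_
    simp
  · have hD : D = ∅ := by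
      ext x
      simp only [Set.mem_empty_iff_false, iff_false]
      intro hx
      obtain ⟨z, -⟩ := hex x hx
      exact hne ⟨z⟩
    change Chainable L _ D
    rw [hD]
    refine ⟨0, 0, fun x hx => absurd hx (Set.notMem_empty x),
      fun x hx => absurd hx (Set.notMem_empty x), fun a r x y hx hy _ hr => ?_⟩
    rwa [show y = x from funext fun i => absurd (hx i) (Set.notMem_empty _)]

/-- Finite structures with a monomorphic decomposition into few blocks are chainable with few
colors. -/
theorem exists_chainable_of_hasDecompositionAtMost (L : FirstOrder.Language.{u, v})
    [L.IsRelational] [Finite (Σ n : ℕ, L.Relations n)] (k : ℕ) :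
    ∃ K : ℕ, ∀ (M : Type w) [L.Structure M] [Finite M],
      HasDecompositionAtMost L M k → Chainable L K (Set.univ : Set M) := by
  classical
  choose Q hQ using exists_chainable_local_bound.{u, v, w} L
  -- With blocks of size at most `s` treated as named points, `k * s + k` colors are needed.
  -- Locality for that many colors fixes the required length of the subsequences, hence the length
  -- `N s` that large blocks must reach; `exists_scale` provides this gap with `s` bounded
  -- uniformly.
  choose N hN using fun s => exists_indiscernible_bound.{u, v, w} L (k * s) k (Q (k * s + k))
  obtain ⟨S, hS⟩ := exists_scale k N
  refine ⟨k * S + k, fun M _ _ hdec => ?_⟩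
  rcases isEmpty_or_nonempty M with hM | hM
  · exact chainable_of_isEmpty _
  have := Fintype.ofFinite M
  obtain ⟨f, hf, hmono⟩ := hdec.exists_coloring
  let B : ℕ → Finset M := fun c => Finset.univ.filter (f · = c)
  have hB : ∀ x c, x ∈ B c ↔ f x = c := by simp [B]
  obtain ⟨s, hsS, hs⟩ := hS fun c => (B c).card
  suffices h : Chainable L (k * s + k) (Set.univ : Set M) from
    h.mono subset_rfl (Nat.add_le_add_right (Nat.mul_le_mul_left k hsS) k)
  obtain ⟨ε, hε⟩ := exists_cover (Finset.univ.filter fun x => (B (f x)).card ≤ s) (k * s) (by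
    rw [Finset.card_eq_sum_card_fiberwise (f := f) (t := Finset.range k)
      (fun x _ => by simpa using hf x), mul_comm]
    refine (Finset.sum_le_card_nsmul _ _ s fun c hc => ?_).trans (by simp [mul_comm])
    rcases Nat.lt_or_ge s (B c).card with h | h
    · rw [Finset.filter_filter, Finset.filter_eq_empty_iff.2]
      · simp
      · rintro x - ⟨h1, rfl⟩
        exact absurd h1 (not_le.2 h)
    · exact (Finset.card_le_card (Finset.filter_subset_filter _ (Finset.filter_subset _ _))).trans
        h)
  have hg : ∀ b : Fin k, ∃ g : ℕ → M, s < (B b).card →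
      (∀ i < N s, f (g i) = b) ∧ Set.InjOn g (Finset.range (N s)) := by
    intro b
    by_cases hb : s < (B b).card
    · obtain ⟨g, hg, hinj⟩ := exists_injOn_sequence (B b) (N s)
        ((hs b).resolve_left (not_le.2 hb))
      exact ⟨g, fun _ => ⟨fun i hi => (hB _ _).1 (hg i hi), hinj⟩⟩
    · exact ⟨fun _ => Classical.arbitrary M, fun h => absurd h hb⟩
  choose g hg using hg
  obtain ⟨A, hA, hind⟩ := hN s M ε g
  have hD := chainable_of_indiscernible ε g A hind
  refine hQ _ M fun X hX => ?_
  -- A set of size at most the locality bound can be copied, block by block and with the same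
  -- counts, into the chainable set built from `ε` and the subsequences. Small blocks lie in it
  -- entirely; large blocks contribute enough terms.
  have hU : ∀ c, ∃ U : Finset M,
      (U : Set M) ⊆ Set.range ε ∪ {x | ∃ b, ∃ i ∈ A b, g b i = x} ∧ (∀ x ∈ U, f x = c) ∧
      U.card = (X.filter (f · = c)).card := by
    intro c
    by_cases hc : s < (B c).card
    · have hck : c < k := by
        obtain ⟨x, hx⟩ := Finset.card_pos.1 (Nat.zero_lt_of_lt hc)
        rw [← (hB x c).1 hx]
        exact hf x
      obtain ⟨hg1, hg2⟩ := hg ⟨c, hck⟩ hc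
      have hAc := hA ⟨c, hck⟩
      obtain ⟨V, hV, hVc⟩ := Finset.exists_subset_card_eq
        (s := (A ⟨c, hck⟩).image (g ⟨c, hck⟩)) (n := (X.filter (f · = c)).card) (by
          rw [Finset.card_image_of_injOn (hg2.mono (Finset.coe_subset.2 hAc.1)), hAc.2]
          exact (Finset.card_filter_le _ _).trans hX)
      refine ⟨V, fun x hx => ?_, fun x hx => ?_, hVc⟩
      · obtain ⟨i, hi, rfl⟩ := Finset.mem_image.1 (hV hx)
        exact Or.inr ⟨_, i, hi, rfl⟩
      · obtain ⟨i, hi, rfl⟩ := Finset.mem_image.1 (hV hx)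
        exact hg1 i (Finset.mem_range.1 (hAc.1 hi))
    · refine ⟨X.filter (f · = c), fun x hx => ?_, fun x hx => (Finset.mem_filter.1 hx).2, rfl⟩
      have hx' : f x = c := (Finset.mem_filter.1 hx).2
      obtain ⟨i, rfl⟩ := hε x (by simpa [hx'] using hc)
      exact Or.inl ⟨i, rfl⟩
  choose U hUD hUf hUc using hU
  obtain ⟨φ⟩ := nonempty_equiv_of_counts f hf hmono X ((Finset.range k).biUnion U) (by
    intro c
    rw [← hUc]
    congr 1
    ext x
    simp only [Finset.mem_filter, Finset.mem_biUnion, Finset.mem_range]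
    constructor
    · intro hx
      have := hUf c x hx
      exact ⟨⟨c, this ▸ hf x, hx⟩, this⟩
    · rintro ⟨⟨c', -, hx⟩, rfl⟩
      rwa [hUf c' x hx])
  rw [← chainable_restriction_iff]
  refine Chainable.of_embedding φ.toEmbedding ((chainable_restriction_iff _ _).2
    (hD.mono (fun x hx => ?_) le_rfl))
  obtain ⟨c, -, hx⟩ := Finset.mem_biUnion.1 (Finset.mem_coe.1 hx)
  exact hUD c hx

end Decomposition

/-! ### Pulling decompositions back along embeddings. -/

section Embedding

variable {L : FirstOrder.Language.{u, v}} [L.IsRelational] {M N : Type*} [L.Structure M]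
  [L.Structure N]

theorem nonempty_equiv_restriction_image (e : N ↪[L] M) (A : Set N) :
    Nonempty (restriction L A ≃[L] restriction L (e '' A)) := by
  refine ⟨equivOfBijective (fun x : restriction L A =>
    (⟨e x.1, x.1, x.2, rfl⟩ : restriction L (e '' A))) ⟨?_, ?_⟩ ?_⟩
  · intro x y hxy
    exact Subtype.ext (e.injective (congrArg Subtype.val hxy))
  · rintro ⟨_, x, hx, rfl⟩
    exact ⟨⟨x, hx⟩, rfl⟩
  · intro a r x
    exact e.map_rel r fun i => (x i).1

theorem IsMonomorphicPart.preimage (e : N ↪[L] M) {B : Set M} (h : IsMonomorphicPart L B) :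
    IsMonomorphicPart L (e ⁻¹' B) := by
  classical
  intro A A' hcard hdiff
  have hc : (A.image e).card = (A'.image e).card := by
    rw [Finset.card_image_of_injective _ e.injective, Finset.card_image_of_injective _ e.injective,
      hcard]
  have hd : ((A.image e : Finset M) : Set M) \ B = ((A'.image e : Finset M) : Set M) \ B := by
    rw [Finset.coe_image, Finset.coe_image, ← Set.image_sdiff_preimage, hdiff,
      Set.image_sdiff_preimage]
  obtain ⟨φ⟩ := h (A.image e) (A'.image e) hc hd
  rw [Finset.coe_image, Finset.coe_image] at φ
  obtain ⟨e₁⟩ := nonempty_equiv_restriction_image e (A : Set N)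
  obtain ⟨e₂⟩ := nonempty_equiv_restriction_image e (A' : Set N)
  exact ⟨e₂.symm.comp (φ.comp e₁)⟩

theorem HasDecompositionAtMost.of_embedding {k : ℕ} (e : N ↪[L] M)
    (h : HasDecompositionAtMost L M k) : HasDecompositionAtMost L N k := by
  obtain ⟨f, hf, hm⟩ := h.exists_coloring
  exact hasDecompositionAtMost_of_coloring (f ∘ e) (fun x => hf _) fun c => (hm c).preimage e

theorem HasFiniteDecomposition.exists_hasDecompositionAtMost (h : HasFiniteDecomposition L M) :
    ∃ k, HasDecompositionAtMost L M k := by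
  obtain ⟨P, hP, hfin⟩ := h
  exact ⟨P.ncard, P, hP, hfin.cast_ncard_eq.ge⟩

end Embedding

/-! ### Hereditary classes, chains of them, and minimal ones. -/

section Classes

variable {L : FirstOrder.Language.{u, v}}

/-- The structure `M` is isomorphic to the structure `S` on an initial segment of the natural
numbers. -/
def IsIsoFin (M : Type w) [L.Structure M] {n : ℕ} (S : L.Structure (Fin n)) : Prop :=
  Nonempty (@FirstOrder.Language.Equiv L M (Fin n) _ S)

theorem IsIsoFin.nonempty_equiv {M N : Type w} [L.Structure M] [L.Structure N] {n : ℕ}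
    {S : L.Structure (Fin n)} (hM : IsIsoFin M S) (hN : IsIsoFin N S) : Nonempty (M ≃[L] N) := by
  obtain ⟨e⟩ := hM
  obtain ⟨e'⟩ := hN
  exact ⟨e'.symm.comp e⟩

theorem exists_isIsoFin (M : Type w) [L.Structure M] [Finite M] :
    ∃ S : L.Structure (Fin (Nat.card M)), IsIsoFin M S :=
  ⟨(Finite.equivFin M).inducedStructure, ⟨(Finite.equivFin M).inducedStructureEquiv⟩⟩

variable [L.IsRelational]

instance finite_structure_fin [Finite (Σ n : ℕ, L.Relations n)] (n : ℕ) :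
    Finite (L.Structure (Fin n)) := by
  let F : L.Structure (Fin n) → ∀ s : Σ a : ℕ, L.Relations a, Set (Fin s.1 → Fin n) :=
    fun S s => {x | S.RelMap s.2 x}
  refine Finite.of_injective F fun S S' h => ?_
  refine FirstOrder.Language.Structure.ext ?_ ?_
  · funext a f
    exact isEmptyElim f
  · funext a r x
    exact congrFun (congrFun h ⟨a, r⟩) x

theorem mem_of_embedding {D : Set (Bundled.{w} L.Structure)} (hD : Hereditary D)
    {M N : Bundled.{w} L.Structure} (hM : M ∈ D) [Finite N] (e : N ↪[L] M) : N ∈ D :=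
  hD M hM ⟨fg_iff_finite.2 inferInstance, ⟨e⟩⟩

/-- In a chain of hereditary classes, some member has no more structures of size at most `q` than
the intersection. -/
theorem exists_mem_chain_small_subset_sInter [Finite (Σ n : ℕ, L.Relations n)]
    {c : Set (Set (Bundled.{w} L.Structure))} (hne : c.Nonempty) (hc : IsChain (· ⊆ ·) c)
    (hfin : ∀ D ∈ c, ∀ M ∈ D, Finite M) (hher : ∀ D ∈ c, Hereditary D) (q : ℕ) :
    ∃ D ∈ c, ∀ M ∈ D, Nat.card M ≤ q → M ∈ ⋂₀ c := by
  let τ : Set (Bundled.{w} L.Structure) → Set (Σ n : Fin (q + 1), L.Structure (Fin n)) :=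
    fun D => {s | ∃ M ∈ D, IsIsoFin M s.2}
  have hτ : Monotone τ := fun D D' h s ⟨M, hM, e⟩ => ⟨M, h hM, e⟩
  -- There are finitely many structures on `Fin n` for `n ≤ q`, so some member of the chain realizes
  -- a minimal set of small isomorphism types; comparability puts these types in every member.
  obtain ⟨D, hD, hmin⟩ := Set.Finite.exists_minimalFor' τ c
    ((Set.toFinite (Set.univ : Set (Set (Σ n : Fin (q + 1), L.Structure (Fin n))))).subset
      (Set.subset_univ _)) hne
  refine ⟨D, hD, fun M hM hcard D' hD' => ?_⟩
  have hle : τ D ≤ τ D' := by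
    rcases hc.total hD hD' with h | h
    · exact hτ h
    · exact hmin hD' (hτ h)
  have := hfin D hD M hM
  obtain ⟨S, e⟩ := exists_isIsoFin (L := L) M
  obtain ⟨N, hN, e'⟩ := hle (a := ⟨⟨Nat.card M, Nat.lt_succ_of_le hcard⟩, S⟩) ⟨M, hM, e⟩
  obtain ⟨φ⟩ := e.nonempty_equiv e'
  exact mem_of_embedding (hher D' hD') hN φ.toEmbedding

/-- A bound on decompositions in the intersection bounds the colors of its structures by some `K`. A
member of the chain with the same structures up to the locality bound for `K` then consists of
`K`-chainable structures only, so its decompositions are bounded too. -/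
theorem hasUnboundedDecompositions_sInter [Finite (Σ n : ℕ, L.Relations n)]
    {c : Set (Set (Bundled.{w} L.Structure))} (hne : c.Nonempty) (hc : IsChain (· ⊆ ·) c)
    (hfin : ∀ D ∈ c, ∀ M ∈ D, Finite M) (hher : ∀ D ∈ c, Hereditary D)
    (hunb : ∀ D ∈ c, HasUnboundedDecompositions D) : HasUnboundedDecompositions (⋂₀ c) := by
  intro k
  by_contra hcon
  push Not at hcon
  obtain ⟨K, hK⟩ := exists_chainable_of_hasDecompositionAtMost.{u, v, w} L (k + 1)
  obtain ⟨q, hq⟩ := exists_chainable_local_bound.{u, v, w} L K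
  obtain ⟨D, hD, hsmall⟩ := exists_mem_chain_small_subset_sInter hne hc hfin hher q
  obtain ⟨M, hM, hMdec⟩ := hunb D hD K
  have := hfin D hD M hM
  refine hMdec (Chainable.hasDecompositionAtMost ?_ |>.mono (Nat.le_succ K))
  refine hq M fun s hs => ?_
  rw [← chainable_restriction_iff]
  have hfs : Finite (restriction L (s : Set M)) := inferInstanceAs (Finite (s : Set M))
  refine hK _ (hcon (⟨restriction L (s : Set M), inferInstance⟩ : Bundled.{w} L.Structure)
    (hsmall _ ?_ ?_))
  · exact mem_of_embedding (N := ⟨restriction L (s : Set M), inferInstance⟩) (hher D hD) hM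
      (restrictionEmbedding _)
  · exact (Set.ncard_coe_finset s).trans_le hs

theorem countable_quotient_of_finite [Finite (Σ n : ℕ, L.Relations n)]
    (D : Set (Bundled.{w} L.Structure)) (hfin : ∀ M ∈ D, Finite M) :
    (Quotient.mk' '' D : Set (Quotient (equivSetoid (L := L)))).Countable := by
  have h : ∀ ξ : (Quotient.mk' '' D : Set (Quotient (equivSetoid (L := L)))),
      ∃ (s : Σ n : ℕ, L.Structure (Fin n)) (M : Bundled.{w} L.Structure), Quotient.mk' M = ξ.1 ∧
        IsIsoFin M s.2 := by
    rintro ⟨_, M, hM, rfl⟩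
    have := hfin M hM
    obtain ⟨S, hS⟩ := exists_isIsoFin (L := L) M
    exact ⟨⟨_, S⟩, M, rfl, hS⟩
  choose s N hN hs using h
  refine Function.Injective.countable (f := s) fun ξ ξ' hξ => Subtype.ext ?_
  rw [← hN ξ, ← hN ξ']
  have h1 := hs ξ
  rw [hξ] at h1
  exact Quotient.sound (h1.nonempty_equiv (hs ξ'))

/-- By minimality, the members not embedding a given `M ∈ A` have bounded decompositions. Hence a
member that needs enough blocks embeds any two prescribed members at once. -/
theorem jointEmbedding_of_minimal {C A : Set (Bundled.{w} L.Structure)}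
    (hA : Minimal (fun D : Set (Bundled.{w} L.Structure) =>
      D ⊆ C ∧ Hereditary D ∧ HasUnboundedDecompositions D) A) : JointEmbedding A := by
  obtain ⟨hAC, hher, hunb⟩ := hA.prop
  have key : ∀ M ∈ A, ∃ k, ∀ X ∈ A, ¬ HasDecompositionAtMost L X (k + 1) →
      Nonempty (M ↪[L] X) := by
    intro M hM
    by_contra hcon
    push Not at hcon
    have hsub : A ⊆ {X ∈ A | IsEmpty (M ↪[L] X)} := by
      refine hA.le_of_le ⟨fun X hX => hAC hX.1, fun X hX Y hY => ⟨hher X hX.1 hY, ?_⟩, ?_⟩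
        fun X hX => hX.1
      · obtain ⟨-, ⟨e⟩⟩ := hY
        exact ⟨fun e' => hX.2.false (e.comp e')⟩
      · intro k
        obtain ⟨X, hX, hXk, hMX⟩ := hcon k
        exact ⟨X, ⟨hX, hMX⟩, hXk⟩
    exact (hsub hM).2.false (FirstOrder.Language.Embedding.refl L M)
  intro M hM N hN
  obtain ⟨k, hk⟩ := key M hM
  obtain ⟨l, hl⟩ := key N hN
  obtain ⟨X, hX, hXdec⟩ := hunb (max k l)
  exact ⟨X, hX, hk X hX fun h => hXdec (h.mono (by omega)), hl X hX fun h =>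
    hXdec (h.mono (by omega))⟩

end Classes

end MonomorphicDecomposition

/-! ### Existence of minimal classes by Zorn's lemma, and their description as ages. -/

theorem lemma2p8 (L : FirstOrder.Language.{u, v}) [L.IsRelational]
    [Finite (Σ n : ℕ, L.Relations n)]
    (C : Set (Bundled.{w} L.Structure)) (hfin : ∀ M ∈ C, Finite M)
    (hher : FirstOrder.Language.Hereditary C)
    (hC : MonomorphicDecomposition.HasUnboundedDecompositions C) :
    (∃ A : Set (Bundled.{w} L.Structure),
      Minimal (fun D : Set (Bundled.{w} L.Structure) =>
        D ⊆ C ∧ FirstOrder.Language.Hereditary D ∧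
          MonomorphicDecomposition.HasUnboundedDecompositions D) A) ∧
    ∀ A : Set (Bundled.{w} L.Structure),
      Minimal (fun D : Set (Bundled.{w} L.Structure) =>
        D ⊆ C ∧ FirstOrder.Language.Hereditary D ∧
          MonomorphicDecomposition.HasUnboundedDecompositions D) A →
      ∃ R : Bundled.{w} L.Structure, A = L.age R ∧
        ¬ MonomorphicDecomposition.HasFiniteDecomposition L R := by
  constructor
  · refine zorn_superset {D : Set (Bundled.{w} L.Structure) |
      D ⊆ C ∧ FirstOrder.Language.Hereditary D ∧
        MonomorphicDecomposition.HasUnboundedDecompositions D} fun c hc hchain => ?_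
    rcases c.eq_empty_or_nonempty with rfl | hne
    · exact ⟨C, ⟨subset_rfl, hher, hC⟩, fun s hs => absurd hs (Set.notMem_empty s)⟩
    · refine ⟨⋂₀ c, ⟨?_, fun M hM N hN D hD => (hc hD).2.1 M (hM D hD) hN, ?_⟩,
        fun D hD => Set.sInter_subset_of_mem hD⟩
      · obtain ⟨D, hD⟩ := hne
        exact (Set.sInter_subset_of_mem hD).trans (hc hD).1
      · exact MonomorphicDecomposition.hasUnboundedDecompositions_sInter hne hchain
          (fun D hD M hM => hfin M ((hc hD).1 hM)) (fun D hD => (hc hD).2.1)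
          fun D hD => (hc hD).2.2
  · intro A hA
    obtain ⟨hAC, hAher, hAunb⟩ := hA.prop
    have hAfin : ∀ M ∈ A, Finite M := fun M hM => hfin M (hAC hM)
    obtain ⟨M₀, hM₀, -⟩ := hAunb 0
    -- Fraïssé's theorem on ages: nonempty, countably many isomorphism types, hereditary, joint
    -- embedding.
    obtain ⟨R, -, hR⟩ := FirstOrder.Language.exists_cg_is_age_of ⟨M₀, hM₀⟩
      (MonomorphicDecomposition.countable_quotient_of_finite A hAfin)
      (fun M hM => by
        have := hAfin M hM
        exact FirstOrder.Language.Structure.fg_iff_finite.2 this)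
      hAher (MonomorphicDecomposition.jointEmbedding_of_minimal hA)
    refine ⟨R, hR.symm, fun hdec => ?_⟩
    obtain ⟨k, hk⟩ := hdec.exists_hasDecompositionAtMost
    obtain ⟨M, hM, hMk⟩ := hAunb k
    rw [← hR] at hM
    obtain ⟨-, ⟨e⟩⟩ := hM
    exact hMk ((hk.of_embedding e).mono (Nat.le_succ k))
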